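/- **Nets.** A multi reversing Petri net (MRPN) $(P,T,A,A_V,B,F)$ consists of finite sets $P$ (places), $T$ (transitions), $A$ (token types), $A_V$ (token variables, each $v$ with a type $\mathrm{type}(v)\in A$), a set $B$ of undirected bond types on $A$, and arc labels $F(x,t),F(t,x)$ ($x\in P$, $t\in T$), which are sets of variables and undirected bonds of variables; if a bond $(u,v)$ lies in a label then so do $u$ and $v$, and the pair of their types is in $B$. Let $\mathrm{pre}(t)=\bigcup_xF(x,t)$ and $\mathrm{post}(t)=\bigcup_xF(t,x)$. The net is well-formed if for every $t$: $A_V\cap\mathrm{pre}(t)=A_V\cap\mathrm{post}(t)$, and no variable lies in both $F(t,x)$ and $F(t,y)$ for $x\ne y$. **States.** Token instances are $(a,*,i)$ ($a\in A$, $i\in\mathbb N$) and, recursively, $(a_i,k,u)$ with $a_i$ a token instance, $k\in\mathbb N$ (a key) and $u\in A_V\cup\{*\}$. The origin of an instance is the $(a,*,i)$ from which it is built, its type is $a$, and $a_i\,\overline\in\,a_j$ means that $a_j$ arises from $a_i$ by adding zero or more memories. A state $\langle M,H\rangle$ consists of a marking $M$ (a set $M(x)$ of token instances and bonds of token instances for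 each place $x$) and a history $H:T\to2^{\mathbb N}$; $(t,k)$ is an occurrence in it if $k\in H(t)$. A state is initial if all its tokens have the form $(a,*,i)$, each lies in at most one place, each bond has its type in $B$ and lies in a place together with both its ends, and $H(t)=\emptyset$ for all $t$. $\mathrm{con}(a,C)$ denotes the tokens of $C$ connected to $a$ via bonds of $C$, together with these bonds. For a map $U$ from variables to instances let $U(\mathrm{pre}(t))$, $U(\mathrm{post}(t))$ be the images of $\mathrm{pre}(t)$, $\mathrm{post}(t)$. **Forward steps.** $\langle M,H\rangle\xrightarrow{(t,k)}\langle M',H'\rangle$ if $k=\max(\{0\}\cup\bigcup_{t'}H(t'))+1$ and there is an injective $U:A_V\cap\mathrm{pre}(t)\to$ instances such that: for $u\in F(x,t)$, $U(u)\in M(x)$ has the type of $u$; for $(u,v)\in F(x,t)$, $(U(u),U(v))\in M(x)$; if $u,v\in F(x,t)$ and $(U(u),U(v))\in M(x)$ then $(u,v)\in F(x,t)$; if $u\in F(t,y_1)$, $v\in F(t,y_2)$ with $y_1\neq y_2$, then $U(u)\notin\mathrm{con}(U(v),(M(x)-U(\mathrm{pre}(t)))\cup U(\mathrm{post}(t)))$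 for all $x$ with $F(x,t)\neq\emptyset$. Then $H'$ is $H$ with $k$ added to $H(t)$, and $M'(x)$ is obtained from $M(x)$ by removing $\mathrm{con}(U(u),M(x))$ for all $u\in F(x,t)$ and adding, for all $u\in F(t,x)$ and $y$ with $U(u)\in M(y)$, the component $\mathrm{con}(U(u),(M(y)-U(\mathrm{pre}(t)))\cup U(\mathrm{post}(t)))$ with each token $a_i$ in it replaced by $(a_i,k,w)$, where $w$ is the variable with $U(w)=a_i$, or $*$ if there is none. **Causal-order reverse steps.** In $\langle M,H\rangle$, $(t,k)\prec(t',k')$ means that both are occurrences, $k<k'$, and some token $a_i$ of $M$ has $(a_j,k,u)\,\overline\in\,a_i$ and $(a_j',k',u')\,\overline\in\,a_i$ for some $a_j,a_j',u,u'$. We write $\langle M,H\rangle\xrightarrow{(\underline{t,k})}\langle M',H'\rangle$ if $k\in H(t)$, no occurrence $(t',k')$ has $(t,k)\prec(t',k')$, and there is an injective $U:A_V\cap\mathrm{post}(t)\to$ instances such that for $u\in F(t,x)$, $U(u)\in M(x)$ has the type of $u$ and the form $(a_i,k,u)$, and for $(u,v)\in F(t,x)$, $(U(u),U(v))\in M(x)$.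 Then $H'$ is $H$ with $k$ removed from $H(t)$, and $M'(x)$ is obtained from $M(x)$ by removing $\mathrm{con}(U(u),M(x))$ for all $u\in F(t,x)$ and adding, for all $u\in F(x,t)$ and $y$ with $U(u)\in M(y)$, all tokens $a_i$ such that some $(a_i,k,w)$, and all bonds $(a_i,b_i)$ such that some $((a_i,k,w),(b_i,k,w'))$, lies in $\mathrm{con}(U(u),(M(y)-U(\mathrm{post}(t)))\cup U(\mathrm{pre}(t)))$. An execution is a finite sequence of forward and causal-order reverse steps. **Equivalent states.** A causal path in a state is a nonempty sequence of occurrences $(t_1,k_1)\prec\dots\prec(t_n,k_n)$. $H\asymp H'$ means that for each causal path $(t_1,k_1),\dots,(t_n,k_n)$ in $\langle M,H\rangle$ there is a causal path $(t_1,k_1'),\dots,(t_n,k_n')$ in $\langle M',H'\rangle$, and vice versa. $M\asymp M'$ means that the markings agree up to keys: there is a bijection $\varphi$ of $\mathbb N$ with $k\in H(t)\iff\varphi(k)\in H'(t)$ for all $t,k$, such that for every place $x$ renaming all keys in $M(x)$ by $\varphi$ gives $M'(x)$. $\langle M,H\rangle\asymp\langle M',H'\rangle$ means $M\asymp M'$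 and $H\asymp H'$. **Equivalent executions.** Two steps perform the same action if they have the same direction and the same transition and assign to each variable tokens of the same origin. Steps $\alpha_1,\alpha_2$ from one state are concurrent if after each of them the action of the other can be performed, so that the two orders lead to $\asymp$-equivalent states. Causal equivalence of executions from the same state is the least equivalence relation such that (i) $\alpha_1;\alpha_2$ and $\alpha_2;\alpha_1$ are equivalent for concurrent $\alpha_1,\alpha_2$ (keys being adapted); (ii) $(t,k);(\underline{t,k})$ is equivalent to the empty execution; (iii) $(\underline{t,k_1});(t,k_2)$ is equivalent to the empty execution if whenever $(a_i,k_1,u)$, with $u$ a variable of $t$, is in place $x$ before the two steps, $(a_i,k_2,u)$ is in $x$ after them; and which is closed under composition: if $e_1,e_2$ are equivalent and $f_1,f_2$ continue them by the same sequence of actions, then $c;e_1;f_1$ and $c;e_2;f_2$ are equivalent for every execution $c$ that they can continue. **Theorem.** Consider a well-formed MRPN, a state $\langle M,H\rangle$ reachable from an initial state by an execution, and executions from $\langle M,H\rangle$ to $\langle M_1,H_1\rangle$ and to $\langle M_2,H_2\rangle$. These are causally equivalent executions if and only if $\langle M_1,H_1\rangle\asymp\langle M_2,H_2\rangle$. 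-/

import Mathlib

namespace MultiRPN

/-- An item over `X` is an element of `X` or an undirected bond between elements of `X`.
Arc labels are sets of items over the token variables; markings assign to each place a set of
items over the token instances. -/
abbrev Item (X : Type*) := X ⊕ Sym2 X

/-- Apply a renaming to an element, or to both ends of a bond. -/
def Item.map {X Y : Type*} (f : X → Y) : Item X → Item Y := Sum.map f (Sym2.map f)

/-- Token instances: `base a i` is the initial instance `(a, *, i)`, and `mem b k u` is the
instance `(b, k, u)`: the instance `b` after taking part in a transition occurrence with key `k`,
in the role of the variable `u`, where `none` stands for `*` (moved along, not selected). -/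
inductive Tok (A V : Type*) where
  | base (a : A) (i : ℕ) : Tok A V
  | mem (b : Tok A V) (k : ℕ) (u : Option V) : Tok A V

namespace Tok
variable {A V : Type*}

/-- The type of a token instance. -/
def ty : Tok A V → A
  | base a _ => a
  | mem b _ _ => b.ty

/-- The initial instance `(a, *, i)` from which an instance has evolved. -/
def origin : Tok A V → A × ℕ
  | base a i => (a, i)
  | mem b _ _ => b.origin

/-- `EvolvedTo a b`: the instance `a` has evolved to `b`, that is, `b` is `a` with possibly more
memories added. -/
inductive EvolvedTo (a : Tok A V) : Tok A V → Prop
  | refl : EvolvedTo a a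
  | mem {b : Tok A V} (k : ℕ) (u : Option V) (h : EvolvedTo a b) : EvolvedTo a (.mem b k u)

/-- Rename all the keys in the memory of an instance. -/
def rekey (φ : ℕ → ℕ) : Tok A V → Tok A V
  | base a i => base a i
  | mem b k u => mem (b.rekey φ) (φ k) u

end Tok

/-- The tokens `b, c` are joined by a bond of `C`, and `c` is in `C`. -/
def Linked {X : Type*} (C : Set (Item X)) (b c : X) : Prop :=
  Sum.inr s(b, c) ∈ C ∧ Sum.inl c ∈ C

/-- The connected component of `a` in `C`: the tokens of `C` connected to `a` via sequences of
bonds of `C`, together with the bonds creating these connections. -/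
def con {X : Type*} (a : X) (C : Set (Item X)) : Set (Item X) :=
  {e | (∃ b, e = Sum.inl b ∧ Sum.inl b ∈ C ∧ Relation.ReflTransGen (Linked C) a b) ∨
       (∃ b c, e = Sum.inr s(b, c) ∧ Relation.ReflTransGen (Linked C) a b ∧ Linked C b c)}

/-- A multi reversing Petri net with places `P`, transitions `T`, token types `A` and token
variables `V`; `inArc x t` is `F(x, t)` and `outArc t x` is `F(t, x)`. If a bond occurs on an arc
then so do its two ends, and it is of a bond type of the net. -/
structure MRPN (P T A V : Type*) where
  varTy : V → A
  bondTy : Set (Sym2 A)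
  inArc : P → T → Set (Item V)
  outArc : T → P → Set (Item V)
  inArc_bond : ∀ x t u v, Sum.inr s(u, v) ∈ inArc x t →
    Sum.inl u ∈ inArc x t ∧ Sum.inl v ∈ inArc x t ∧ s(varTy u, varTy v) ∈ bondTy
  outArc_bond : ∀ t x u v, Sum.inr s(u, v) ∈ outArc t x →
    Sum.inl u ∈ outArc t x ∧ Sum.inl v ∈ outArc t x ∧ s(varTy u, varTy v) ∈ bondTy

/-- A state `⟨M, H⟩`: a marking and a history. -/
@[ext] structure State (P T A V : Type*) where
  M : P → Set (Item (Tok A V))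
  H : T → Set ℕ

/-- Actions: the forward occurrence `(t, k)`, or its reversal. -/
inductive Action (T : Type*) where
  | fwd (t : T) (k : ℕ) : Action T
  | rev (t : T) (k : ℕ) : Action T

namespace MRPN
variable {P T A V : Type*} (N : MRPN P T A V)

/-- The variables on the incoming arcs of `t`. -/
def guardVars (t : T) : Set V := {u | ∃ x, Sum.inl u ∈ N.inArc x t}

/-- The variables on the outgoing arcs of `t`. -/
def effectVars (t : T) : Set V := {u | ∃ x, Sum.inl u ∈ N.outArc t x}

/-- Transitions neither erase nor create tokens, and do not send a token to two places. -/
def WellFormed : Prop :=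
  ∀ t, N.guardVars t = N.effectVars t ∧
    ∀ x y u, x ≠ y → ¬ (Sum.inl u ∈ N.outArc t x ∧ Sum.inl u ∈ N.outArc t y)

/-- Initial states: all tokens are initial instances, each in at most one place; the ends of a
bond lie in the same place as the bond, whose type is a bond type; the history is empty. -/
structure Initial (S : State P T A V) : Prop where
  base : ∀ x a, Sum.inl a ∈ S.M x → ∃ b i, a = Tok.base b i
  unique : ∀ a x y, Sum.inl a ∈ S.M x → Sum.inl a ∈ S.M y → x = y
  bond : ∀ x a b, Sum.inr s(a, b) ∈ S.M x →
    Sum.inl a ∈ S.M x ∧ Sum.inl b ∈ S.M x ∧ s(a.ty, b.ty) ∈ N.bondTy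
  hist : ∀ t, S.H t = ∅

/-- The token and bond instances required on the incoming arcs of `t` under the assignment `U`.
Only the values of an assignment on the variables of `t` matter. -/
def preItems (t : T) (U : V → Tok A V) : Set (Item (Tok A V)) :=
  {e | ∃ x, ∃ l ∈ N.inArc x t, e = Item.map U l}

/-- The token and bond instances on the outgoing arcs of `t` under the assignment `U`. -/
def postItems (t : T) (U : V → Tok A V) : Set (Item (Tok A V)) :=
  {e | ∃ x, ∃ l ∈ N.outArc t x, e = Item.map U l}

/-- `U` is a forward enabling assignment for `t` in `S`. -/
structure FwdEnabled (S : State P T A V) (t : T) (U : V → Tok A V) : Prop where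
  inj : Set.InjOn U (N.guardVars t)
  tokens : ∀ x u, Sum.inl u ∈ N.inArc x t → Sum.inl (U u) ∈ S.M x ∧ N.varTy u = (U u).ty
  bonds : ∀ x u v, Sum.inr s(u, v) ∈ N.inArc x t → Sum.inr s(U u, U v) ∈ S.M x
  noRecreate : ∀ x u v, Sum.inl u ∈ N.inArc x t → Sum.inl v ∈ N.inArc x t →
    Sum.inr s(U u, U v) ∈ S.M x → Sum.inr s(u, v) ∈ N.inArc x t
  noClone : ∀ u v y₁ y₂, y₁ ≠ y₂ → Sum.inl u ∈ N.outArc t y₁ → Sum.inl v ∈ N.outArc t y₂ →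
    ∀ x, (N.inArc x t).Nonempty →
      Sum.inl (U u) ∉ con (U v) ((S.M x \ N.preItems t U) ∪ N.postItems t U)

/-- Items removed from place `x` by the forward firing of `t`. -/
def fwdIn (S : State P T A V) (t : T) (U : V → Tok A V) (x : P) : Set (Item (Tok A V)) :=
  {e | ∃ u, Sum.inl u ∈ N.inArc x t ∧ e ∈ con (U u) (S.M x)}

/-- Items sent to place `x` by the forward firing of `t`, before memories are extended. -/
def fwdOut (S : State P T A V) (t : T) (U : V → Tok A V) (x : P) : Set (Item (Tok A V)) :=
  {e | ∃ u y, Sum.inl u ∈ N.outArc t x ∧ Sum.inl (U u) ∈ S.M y ∧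
    e ∈ con (U u) ((S.M y \ N.preItems t U) ∪ N.postItems t U)}

open Classical in
/-- The variable of `t` to which the instance `a` is assigned by `U`, or `none` (for `*`). -/
noncomputable def role (t : T) (U : V → Tok A V) (a : Tok A V) : Option V :=
  if h : ∃ u ∈ N.guardVars t, U u = a then some h.choose else none

/-- `⟨M, H⟩ -(t,k)-> ⟨M', H'⟩`, the forward execution of `t` with the assignment `U`. -/
structure FwdStepWith (S : State P T A V) (t : T) (k : ℕ) (U : V → Tok A V)
    (S' : State P T A V) : Prop where
  enabled : N.FwdEnabled S t U
  key : ∃ m, IsGreatest ({0} ∪ {k' | ∃ t', k' ∈ S.H t'}) m ∧ k = m + 1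
  marking : ∀ x, S'.M x = (S.M x \ N.fwdIn S t U x) ∪
    Item.map (fun a => Tok.mem a k (N.role t U a)) '' N.fwdOut S t U x
  hist : ∀ t', S'.H t' = {k' | k' ∈ S.H t' ∨ (t' = t ∧ k' = k)}

/-- `(t', k')` causally depends on `(t, k)` in `S`. -/
def Prec (S : State P T A V) (o o' : T × ℕ) : Prop :=
  o.2 ∈ S.H o.1 ∧ o'.2 ∈ S.H o'.1 ∧ o.2 < o'.2 ∧
    ∃ x a b u b' u', Sum.inl a ∈ S.M x ∧
      Tok.EvolvedTo (Tok.mem b o.2 u) a ∧ Tok.EvolvedTo (Tok.mem b' o'.2 u') a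

/-- The occurrence `(t, k)` is c-enabled in `S`, with the causal enabling assignment `U`. -/
structure RevEnabled (S : State P T A V) (t : T) (k : ℕ) (U : V → Tok A V) : Prop where
  occ : k ∈ S.H t
  last : ∀ o', ¬ Prec S (t, k) o'
  inj : Set.InjOn U (N.effectVars t)
  tokens : ∀ x u, Sum.inl u ∈ N.outArc t x →
    (∃ a, U u = Tok.mem a k (some u)) ∧ Sum.inl (U u) ∈ S.M x ∧ N.varTy u = (U u).ty
  bonds : ∀ x u v, Sum.inr s(u, v) ∈ N.outArc t x → Sum.inr s(U u, U v) ∈ S.M x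

/-- Items removed from place `x` by the reversal of `t`. -/
def revIn (S : State P T A V) (t : T) (U : V → Tok A V) (x : P) : Set (Item (Tok A V)) :=
  {e | ∃ u, Sum.inl u ∈ N.outArc t x ∧ e ∈ con (U u) (S.M x)}

/-- Items sent to place `x` by the reversal of `t`, before memories are shortened. -/
def revOut (S : State P T A V) (t : T) (U : V → Tok A V) (x : P) : Set (Item (Tok A V)) :=
  {e | ∃ u y, Sum.inl u ∈ N.inArc x t ∧ Sum.inl (U u) ∈ S.M y ∧
    e ∈ con (U u) ((S.M y \ N.postItems t U) ∪ N.preItems t U)}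

/-- The causal-order reversal of the occurrence `(t, k)`, with the assignment `U`. -/
structure RevStepWith (S : State P T A V) (t : T) (k : ℕ) (U : V → Tok A V)
    (S' : State P T A V) : Prop where
  enabled : N.RevEnabled S t k U
  marking : ∀ x, S'.M x = (S.M x \ N.revIn S t U x) ∪
    ({e | ∃ a u, e = Sum.inl a ∧ Sum.inl (Tok.mem a k u) ∈ N.revOut S t U x} ∪
     {e | ∃ a u b v, e = Sum.inr s(a, b) ∧
        Sum.inr s(Tok.mem a k u, Tok.mem b k v) ∈ N.revOut S t U x})
  hist : ∀ t', S'.H t' = {k' | k' ∈ S.H t' ∧ ¬ (t' = t ∧ k' = k)}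

/-- One forward or causal-order reverse step. -/
def Step (S : State P T A V) : Action T → State P T A V → Prop
  | .fwd t k, S' => ∃ U, N.FwdStepWith S t k U S'
  | .rev t k, S' => ∃ U, N.RevStepWith S t k U S'

/-- Executions: finite sequences of forward and causal-order reverse steps. -/
inductive Exec : State P T A V → State P T A V → Type _
  | nil (S : State P T A V) : Exec S S
  | cons {S S' S'' : State P T A V} (α : Action T) (h : N.Step S α S') (e : Exec S' S'') :
      Exec S S''

/-- Composition of executions. -/
def Exec.comp {N : MRPN P T A V} {S S' S'' : State P T A V} :
    N.Exec S S' → N.Exec S' S'' → N.Exec S S''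
  | .nil _, f => f
  | .cons α h e, f => .cons α h (e.comp f)

/-- A state is reachable if some execution leads to it from an initial state. -/
def Reachable (S : State P T A V) : Prop := ∃ S₀, N.Initial S₀ ∧ Nonempty (N.Exec S₀ S)

/-- A causal path: a nonempty sequence of transition occurrences, each causing the next. -/
def CausalPath (S : State P T A V) (p : List (T × ℕ)) : Prop :=
  p ≠ [] ∧ (∀ o ∈ p, o.2 ∈ S.H o.1) ∧ p.IsChain (Prec S)

/-- Causal equivalence of histories: the same causal paths, up to keys. -/
def HistEquiv (S S' : State P T A V) : Prop :=
  (∀ p, CausalPath S p → ∃ q, CausalPath S' q ∧ q.map Prod.fst = p.map Prod.fst) ∧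
  (∀ q, CausalPath S' q → ∃ p, CausalPath S p ∧ p.map Prod.fst = q.map Prod.fst)

/-- Causal equivalence of markings: the same token and bond instances in the same places, having
taken part in the same transitions, up to the choice of keys: one renaming of keys carries the
occurrences of each transition to occurrences of it, and one marking to the other. -/
def MarkEquiv (S S' : State P T A V) : Prop :=
  ∃ φ : Equiv.Perm ℕ, (∀ t k, k ∈ S.H t ↔ φ k ∈ S'.H t) ∧
    ∀ x, S'.M x = Item.map (Tok.rekey φ) '' S.M x

/-- Causal equivalence of states. -/
def StateEquiv (S S' : State P T A V) : Prop := MarkEquiv S S' ∧ HistEquiv S S'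

/-- Occurrences `(t, k₁)` and `(t, k₂)`, performed in markings `M₁` and `M₂`, are equivalent: the
same token instances have been assigned to the variables of `t`. -/
def EquivOcc (t : T) (M₁ : P → Set (Item (Tok A V))) (k₁ : ℕ)
    (M₂ : P → Set (Item (Tok A V))) (k₂ : ℕ) : Prop :=
  ∀ x a, ∀ u ∈ N.guardVars t, Sum.inl (Tok.mem a k₁ (some u)) ∈ M₁ x →
    Sum.inl (Tok.mem a k₂ (some u)) ∈ M₂ x

/-- In `M`, the token with origin `o` has been assigned to the variable `u` of `t` by the
occurrence with key `k`, as its latest memory. -/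
def Uses (t : T) (M : P → Set (Item (Tok A V))) (k : ℕ) (u : V) (o : A × ℕ) : Prop :=
  u ∈ N.guardVars t ∧ ∃ x a, a.origin = o ∧ Sum.inl (Tok.mem a k (some u)) ∈ M x

/-- The steps `S₁ -α-> S₁'` and `S₂ -β-> S₂'` perform the same action up to keys: the same
transition in the same direction, manipulating the same tokens in the same roles. (The memory of
an occurrence is found after a forward step and before a reverse step.) -/
def SameAction (S₁ : State P T A V) (α : Action T) (S₁' S₂ : State P T A V) (β : Action T)
    (S₂' : State P T A V) : Prop :=
  match α, β with
  | .fwd t k, .fwd t' k' => t = t' ∧ ∀ u o, N.Uses t S₁'.M k u o ↔ N.Uses t S₂'.M k' u o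
  | .rev t k, .rev t' k' => t = t' ∧ ∀ u o, N.Uses t S₁.M k u o ↔ N.Uses t S₂.M k' u o
  | _, _ => False

/-- The actions of the steps `S -α₁-> S₁` and `S -α₂-> S₂` are concurrent in `S`: each can be
followed by the other, and the two orders lead to causally equivalent states. -/
def Concurrent (S : State P T A V) (α₁ : Action T) (S₁ : State P T A V) (α₂ : Action T)
    (S₂ : State P T A V) : Prop :=
  ∃ β₂ S' β₁ S'', N.Step S₁ β₂ S' ∧ N.SameAction S α₂ S₂ S₁ β₂ S' ∧
    N.Step S₂ β₁ S'' ∧ N.SameAction S α₁ S₁ S₂ β₁ S'' ∧ StateEquiv S' S''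

/-- Two executions perform the same sequence of actions up to keys. -/
inductive SameTrace : ∀ {S₁ S₁' S₂ S₂' : State P T A V}, N.Exec S₁ S₁' → N.Exec S₂ S₂' → Prop
  | nil (S₁ S₂ : State P T A V) : SameTrace (.nil S₁) (.nil S₂)
  | cons {S₁ R₁ S₁' S₂ R₂ S₂' : State P T A V} {α β : Action T}
      (h₁ : N.Step S₁ α R₁) (h₂ : N.Step S₂ β R₂) {e₁ : N.Exec R₁ S₁'} {e₂ : N.Exec R₂ S₂'}
      (h : N.SameAction S₁ α R₁ S₂ β R₂) (he : SameTrace e₁ e₂) :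
      SameTrace (.cons α h₁ e₁) (.cons β h₂ e₂)

/-- Causal equivalence of executions from the same state: the least equivalence relation closed
under composition (with a common execution before, and with the same actions, up to keys, after)
such that concurrent actions may be swapped, an occurrence followed by its reversal may be
cancelled, and so may a reversal followed by an equivalent forward occurrence. -/
inductive CausEq : ∀ {S S₁ S₂ : State P T A V}, N.Exec S S₁ → N.Exec S S₂ → Prop
  | refl {S S₁ : State P T A V} (e : N.Exec S S₁) : CausEq e e
  | symm {S S₁ S₂ : State P T A V} {e₁ : N.Exec S S₁} {e₂ : N.Exec S S₂} :
      CausEq e₁ e₂ → CausEq e₂ e₁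
  | trans {S S₁ S₂ S₃ : State P T A V} {e₁ : N.Exec S S₁} {e₂ : N.Exec S S₂}
      {e₃ : N.Exec S S₃} : CausEq e₁ e₂ → CausEq e₂ e₃ → CausEq e₁ e₃
  | comp {S₀ S S₁ S₂ S₁' S₂' : State P T A V} (c : N.Exec S₀ S) {e₁ : N.Exec S S₁}
      {e₂ : N.Exec S S₂} {f₁ : N.Exec S₁ S₁'} {f₂ : N.Exec S₂ S₂'} :
      CausEq e₁ e₂ → N.SameTrace f₁ f₂ → CausEq (c.comp (e₁.comp f₁)) (c.comp (e₂.comp f₂))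
  | swap {S S₁ S₂ S' S'' : State P T A V} {α₁ α₂ β₁ β₂ : Action T}
      (h₁ : N.Step S α₁ S₁) (k₂ : N.Step S₁ β₂ S') (h₂ : N.Step S α₂ S₂)
      (k₁ : N.Step S₂ β₁ S'') (hc : N.Concurrent S α₁ S₁ α₂ S₂)
      (s₂ : N.SameAction S α₂ S₂ S₁ β₂ S') (s₁ : N.SameAction S α₁ S₁ S₂ β₁ S'') :
      CausEq (.cons α₁ h₁ (.cons β₂ k₂ (.nil S'))) (.cons α₂ h₂ (.cons β₁ k₁ (.nil S'')))
  | cancelFwdRev {S S' S'' : State P T A V} {t : T} {k : ℕ}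
      (h : N.Step S (.fwd t k) S') (h' : N.Step S' (.rev t k) S'') :
      CausEq (.cons _ h (.cons _ h' (.nil S''))) (.nil S)
  | cancelRevFwd {S S' S'' : State P T A V} {t : T} {k₁ k₂ : ℕ}
      (h : N.Step S (.rev t k₁) S') (h' : N.Step S' (.fwd t k₂) S'')
      (heq : N.EquivOcc t S.M k₁ S''.M k₂) :
      CausEq (.cons _ h (.cons _ h' (.nil S''))) (.nil S)

end MRPN

end MultiRPN

/-!
Firing a transition cuts the components of the selected tokens out of the marking, rearranges them
according to the arcs, and stamps every token in them with the new key. Such a rearrangement can be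
undone, and up to the choice of a fresh key it is determined by the transition and the origins of
the selected tokens. An occurrence on which no other depends acts on components that later steps
left alone, hence commutes with these, so it can be taken to be the last one; a causal-order
reversal therefore exactly undoes a firing.

It follows that each rule generating causal equivalence preserves the final state up to a renaming
of keys. For the converse, consider first executions into a state with empty history. A forward
step can be cancelled against a reversal of it chosen as the first step of the rest, so that every
such execution is equivalent to one that only reverses, and any two of the latter agree because
distinct reversals commute. In general, undo the last occurrence of the two final states, compare
the extended executions by induction on the number of occurrences, and redo it.
-/

namespace MultiRPN

open Relation (ReflTransGen)

section Components
variable {X Y Z : Type*}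

theorem Item.map_map (g : Y → Z) (f : X → Y) (e : Item X) :
    Item.map g (Item.map f e) = Item.map (fun a => g (f a)) e := by
  rcases e with a | ⟨a, b⟩ <;> rfl

theorem Item.map_injective {f : X → Y} (hf : f.Injective) : (Item.map f).Injective :=
  Sum.map_injective.2 ⟨hf, Sym2.map.injective hf⟩

theorem Item.inl_mem_image {f : X → Y} {C : Set (Item X)} {b : Y} :
    Sum.inl b ∈ Item.map f '' C ↔ ∃ a, b = f a ∧ Sum.inl a ∈ C := by
  constructor
  · rintro ⟨a | ⟨a, c⟩, h, h'⟩
    · exact ⟨a, (Sum.inl.inj h').symm, h⟩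
    · cases h'
  · rintro ⟨a, rfl, h⟩
    exact ⟨_, h, rfl⟩

theorem Item.inr_mem_image {f : X → Y} {C : Set (Item X)} {b d : Y} :
    Sum.inr s(b, d) ∈ Item.map f '' C ↔ ∃ a c, b = f a ∧ d = f c ∧ Sum.inr s(a, c) ∈ C := by
  constructor
  · rintro ⟨a | ⟨a, c⟩, h, h'⟩
    · cases h'
    · rcases Sym2.eq_iff.1 (Sum.inr.inj h' : s(f a, f c) = s(b, d)) with ⟨rfl, rfl⟩ | ⟨rfl, rfl⟩
      · exact ⟨a, c, rfl, rfl, h⟩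
      · exact ⟨c, a, rfl, rfl, by rwa [Sym2.eq_swap]⟩
  · rintro ⟨a, c, rfl, rfl, h⟩
    exact ⟨_, h, rfl⟩

/-- A set of items that contains the ends of its bonds. -/
def Closed (C : Set (Item X)) : Prop := ∀ a b, Sum.inr s(a, b) ∈ C → Sum.inl a ∈ C

theorem Closed.right {C : Set (Item X)} (hC : Closed C) {a b : X} (h : Sum.inr s(a, b) ∈ C) :
    Sum.inl b ∈ C := hC b a (by rwa [Sym2.eq_swap])

theorem Closed.linked {C : Set (Item X)} (hC : Closed C) {a b : X} (h : Sum.inr s(a, b) ∈ C) :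
    Linked C a b := ⟨h, hC.right h⟩

theorem Closed.image {C : Set (Item X)} (hC : Closed C) (f : X → Y) : Closed (Item.map f '' C) := by
  intro a b h
  obtain ⟨a, b, rfl, rfl, h'⟩ := Item.inr_mem_image.1 h
  exact ⟨_, hC _ _ h', rfl⟩

theorem Item.image_congr {f g : X → Y} {C : Set (Item X)} (hC : Closed C)
    (h : ∀ a, Sum.inl a ∈ C → f a = g a) : Item.map f '' C = Item.map g '' C := by
  refine Set.image_congr ?_
  rintro (a | ⟨a, b⟩) he
  · exact congrArg Sum.inl (h a he)
  · exact congrArg₂ (fun a b => Sum.inr s(a, b)) (h a (hC _ _ he)) (h b (hC.right he))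

/-- Connectedness through the bonds of `C`. -/
abbrev Conn (C : Set (Item X)) : X → X → Prop := ReflTransGen (Linked C)

theorem Conn.mono {C D : Set (Item X)} (h : C ⊆ D) {a b : X} (hc : Conn C a b) : Conn D a b :=
  hc.lift id fun _ _ hl => ⟨h hl.1, h hl.2⟩

theorem Conn.symm {C : Set (Item X)} (hC : Closed C) {a b : X} (h : Conn C a b) : Conn C b a := by
  induction h with
  | refl => exact .refl
  | tail _ hl ih => exact .head ⟨by rw [Sym2.eq_swap]; exact hl.1, hC _ _ hl.1⟩ ih

theorem Conn.mem {C : Set (Item X)} {a b : X} (h : Conn C a b) (ha : Sum.inl a ∈ C) :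
    Sum.inl b ∈ C := by
  rcases h.cases_tail with rfl | ⟨_, -, hl⟩
  exacts [ha, hl.2]

theorem inl_mem_con {C : Set (Item X)} {a b : X} :
    Sum.inl b ∈ con a C ↔ Sum.inl b ∈ C ∧ Conn C a b := by
  constructor
  · rintro (⟨c, h, h'⟩ | ⟨c, d, h, -⟩)
    · cases h; exact h'
    · cases h
  · exact fun h => Or.inl ⟨b, rfl, h⟩

theorem inr_mem_con {C : Set (Item X)} (hC : Closed C) {a b c : X} :
    Sum.inr s(b, c) ∈ con a C ↔ Sum.inr s(b, c) ∈ C ∧ Conn C a b := by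
  constructor
  · rintro (⟨d, h, -⟩ | ⟨d, e, h, h1, h2⟩)
    · cases h
    · rcases Sym2.eq_iff.1 (Sum.inr.inj h) with ⟨rfl, rfl⟩ | ⟨rfl, rfl⟩
      · exact ⟨h2.1, h1⟩
      · exact ⟨by rw [Sym2.eq_swap]; exact h2.1, h1.tail h2⟩
  · exact fun h => Or.inr ⟨b, c, rfl, h.2, hC.linked h.1⟩

theorem con_subset {C : Set (Item X)} {a : X} : con a C ⊆ C := by
  rintro e (⟨c, rfl, h, -⟩ | ⟨c, d, rfl, -, h⟩)
  exacts [h, h.1]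

theorem con_mono {C D : Set (Item X)} (h : C ⊆ D) (a : X) : con a C ⊆ con a D := by
  rintro e (⟨c, rfl, h1, h2⟩ | ⟨c, d, rfl, h1, h2⟩)
  · exact Or.inl ⟨c, rfl, h h1, Conn.mono h h2⟩
  · exact Or.inr ⟨c, d, rfl, Conn.mono h h1, h h2.1, h h2.2⟩

theorem con_eq_of_saturated {C D : Set (Item X)} (hC : Closed C) (hCD : C ⊆ D)
    (sat : ∀ b c, Sum.inl b ∈ C → Sum.inr s(b, c) ∈ D → Sum.inr s(b, c) ∈ C) {a : X}
    (ha : Sum.inl a ∈ C) : con a D = con a C := by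
  have conn : ∀ b, Conn D a b → Conn C a b := fun b h => by
    induction h with
    | refl => exact .refl
    | tail _ hl ih => exact ih.tail (hC.linked (sat _ _ (ih.mem ha) hl.1))
  refine Set.Subset.antisymm ?_ (con_mono hCD a)
  rintro e (⟨c, rfl, -, h⟩ | ⟨c, d, rfl, h, hl⟩)
  · exact inl_mem_con.2 ⟨(conn _ h).mem ha, conn _ h⟩
  · exact (inr_mem_con hC).2 ⟨sat _ _ ((conn _ h).mem ha) hl.1, conn _ h⟩

theorem Linked.image {f : X → Y} {C : Set (Item X)} {a b : X} (h : Linked C a b) :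
    Linked (Item.map f '' C) (f a) (f b) := ⟨⟨_, h.1, rfl⟩, ⟨_, h.2, rfl⟩⟩

theorem Linked.of_image {f : X → Y} (hf : f.Injective) {C : Set (Item X)} {a : X} {b' : Y}
    (h : Linked (Item.map f '' C) (f a) b') : ∃ b, b' = f b ∧ Linked C a b := by
  obtain ⟨a₁, b, e₁, rfl, hbond⟩ := Item.inr_mem_image.1 h.1
  obtain ⟨b₁, e₂, htok⟩ := Item.inl_mem_image.1 h.2
  cases hf e₁
  cases hf e₂
  exact ⟨b, rfl, hbond, htok⟩

theorem Conn.of_image {f : X → Y} (hf : f.Injective) {C : Set (Item X)} {a : X} {b' : Y}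
    (h : Conn (Item.map f '' C) (f a) b') : ∃ b, b' = f b ∧ Conn C a b := by
  induction h with
  | refl => exact ⟨a, rfl, .refl⟩
  | tail _ hl ih =>
    obtain ⟨b, rfl, hb⟩ := ih
    obtain ⟨c, rfl, hc⟩ := hl.of_image hf
    exact ⟨c, rfl, hb.tail hc⟩

theorem con_image {f : X → Y} (hf : f.Injective) (a : X) (C : Set (Item X)) :
    con (f a) (Item.map f '' C) = Item.map f '' con a C := by
  have conn : ∀ b, Conn C a b → Conn (Item.map f '' C) (f a) (f b) :=
    fun b h => h.lift f fun _ _ => Linked.image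
  apply Set.Subset.antisymm
  · rintro e (⟨c, rfl, hc, h⟩ | ⟨c, d, rfl, h, hl⟩)
    · obtain ⟨b, rfl, hb⟩ := Conn.of_image hf h
      exact ⟨Sum.inl b, inl_mem_con.2 ⟨((Item.map_injective hf).mem_set_image).1 hc, hb⟩, rfl⟩
    · obtain ⟨b, rfl, hb⟩ := Conn.of_image hf h
      obtain ⟨d, rfl, hd⟩ := hl.of_image hf
      exact ⟨Sum.inr s(b, d), Or.inr ⟨b, d, rfl, hb, hd⟩, rfl⟩
  · rintro _ ⟨e, ⟨c, rfl, hc, h⟩ | ⟨c, d, rfl, h, hl⟩, rfl⟩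
    · exact Or.inl ⟨f c, rfl, ⟨_, hc, rfl⟩, conn _ h⟩
    · exact Or.inr ⟨f c, f d, rfl, conn _ h, hl.image⟩

end Components

section Markings
variable {X Y P : Type*}

/-- The items of a marking or of the arcs of a transition, over all places. -/
def total (M : P → Set (Item X)) : Set (Item X) := {e | ∃ x, e ∈ M x}

/-- The image of a marking under a map of instances. -/
def mapMarking (f : X → Y) (M : P → Set (Item X)) (x : P) : Set (Item Y) := Item.map f '' M x

/-- The items of `G`, with those of `I` replaced by those of `O`. -/
def splice (G I O : Set (Item X)) : Set (Item X) := (G \ I) ∪ O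

/-- The components of `G` containing a token of `L`, each sent to the place where `L` has that
token. -/
def gather (G : Set (Item X)) (L : P → Set (Item X)) (x : P) : Set (Item X) :=
  {e | ∃ c, Sum.inl c ∈ L x ∧ e ∈ con c G}

/-- Markings in which bonds lie together with their ends and tokens lie in one place only. -/
structure Proper (M : P → Set (Item X)) : Prop where
  closed : ∀ x, Closed (M x)
  unique : ∀ a x y, Sum.inl a ∈ M x → Sum.inl a ∈ M y → x = y

variable {M I O B C E : P → Set (Item X)}

theorem total_sup (B E : P → Set (Item X)) : total (B ⊔ E) = total B ∪ total E :=
  Set.ext fun _ => exists_or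

theorem subset_total (M : P → Set (Item X)) (x : P) : M x ⊆ total M := fun _ h => ⟨x, h⟩

theorem total_mono (h : B ≤ M) : total B ⊆ total M := fun _ ⟨x, hx⟩ => ⟨x, h x hx⟩

theorem closed_total (h : ∀ x, Closed (M x)) : Closed (total M) :=
  fun _ _ ⟨x, hx⟩ => ⟨x, h x _ _ hx⟩

theorem total_mapMarking (f : X → Y) (M : P → Set (Item X)) :
    total (mapMarking f M) = Item.map f '' total M := by
  ext e
  constructor
  · rintro ⟨x, a, h, rfl⟩
    exact ⟨a, ⟨x, h⟩, rfl⟩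
  · rintro ⟨a, ⟨x, h⟩, rfl⟩
    exact ⟨x, a, h, rfl⟩

theorem mapMarking_sup (f : X → Y) (B E : P → Set (Item X)) :
    mapMarking f (B ⊔ E) = mapMarking f B ⊔ mapMarking f E :=
  funext fun _ => Set.image_union ..

theorem mapMarking_mapMarking {Z : Type*} (g : Y → Z) (f : X → Y) (M : P → Set (Item X)) :
    mapMarking g (mapMarking f M) = mapMarking (fun a => g (f a)) M := by
  funext x
  simp only [mapMarking, Set.image_image, Item.map_map]

theorem mapMarking_congr {f g : X → Y} (hM : ∀ x, Closed (M x))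
    (h : ∀ x a, Sum.inl a ∈ M x → f a = g a) : mapMarking f M = mapMarking g M :=
  funext fun x => Item.image_congr (hM x) (h x)

theorem mapMarking_id (M : P → Set (Item X)) : mapMarking id M = M := by
  funext x
  have map_id : (Item.map id : Item X → Item X) = id := by
    rw [Item.map, Sym2.map_id, Sum.map_id_id]
  rw [mapMarking, map_id, Set.image_id]

theorem splice_mono_left {G G' : Set (Item X)} (h : G ⊆ G') (I O : Set (Item X)) :
    splice G I O ⊆ splice G' I O :=
  Set.union_subset_union_left _ (Set.sdiff_subset_sdiff_left h)

theorem splice_image {f : X → Y} (hf : f.Injective) (G I O : Set (Item X)) :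
    splice (Item.map f '' G) (Item.map f '' I) (Item.map f '' O) = Item.map f '' splice G I O := by
  simp only [splice, Set.image_union, Set.image_sdiff (Item.map_injective hf)]

theorem splice_splice {G I O : Set (Item X)} (hI : I ⊆ G) (hO : G ∩ O ⊆ I) :
    splice (splice G I O) O I = G := by
  ext e
  constructor
  · rintro (⟨⟨hG, -⟩ | h, hO⟩ | h)
    exacts [hG, absurd h hO, hI h]
  · intro h
    by_cases hI : e ∈ I
    · exact Or.inr hI
    · exact Or.inl ⟨Or.inl ⟨h, hI⟩, fun h' => hI (hO ⟨h, h'⟩)⟩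

theorem inl_mem_splice {G I O : Set (Item X)} {a : X} (h : Sum.inl a ∈ I → Sum.inl a ∈ O)
    (ha : Sum.inl a ∈ G) : Sum.inl a ∈ splice G I O := by
  by_cases hI : Sum.inl a ∈ I
  exacts [Or.inr (h hI), Or.inl ⟨ha, hI⟩]

theorem closed_splice {G I O : Set (Item X)} (hG : Closed G) (hO : Closed O)
    (h : ∀ a, Sum.inl a ∈ I → Sum.inl a ∈ O) : Closed (splice G I O) := by
  rintro a b (⟨hab, -⟩ | hab)
  exacts [inl_mem_splice (h a) (hG _ _ hab), Or.inr (hO _ _ hab)]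

theorem gather_mapMarking {f : X → Y} (hf : f.Injective) (G : Set (Item X))
    (L : P → Set (Item X)) :
    gather (Item.map f '' G) (mapMarking f L) = mapMarking f (gather G L) := by
  ext x e
  constructor
  · rintro ⟨_, hc, he⟩
    obtain ⟨c, rfl, hcL⟩ := Item.inl_mem_image.1 hc
    rw [con_image hf] at he
    obtain ⟨d, hd, rfl⟩ := he
    exact ⟨d, ⟨c, hcL, hd⟩, rfl⟩
  · rintro ⟨d, ⟨c, hc, hd⟩, rfl⟩
    exact ⟨f c, ⟨_, hc, rfl⟩, con_image hf c G ▸ ⟨d, hd, rfl⟩⟩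

theorem closed_gather {G : Set (Item X)} (hG : Closed G) (L : P → Set (Item X)) (x : P) :
    Closed (gather G L x) := by
  rintro a b ⟨c, hc, h⟩
  obtain ⟨hab, hca⟩ := (inr_mem_con hG).1 h
  exact ⟨c, hc, inl_mem_con.2 ⟨hG _ _ hab, hca⟩⟩

theorem le_gather {G : Set (Item X)} {L : P → Set (Item X)} (hG : Closed G)
    (hL : ∀ x, Closed (L x)) (h : total L ⊆ G) : L ≤ gather G L := by
  rintro x (a | ⟨a, b⟩) he
  · exact ⟨a, he, inl_mem_con.2 ⟨h ⟨x, he⟩, .refl⟩⟩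
  · exact ⟨a, hL x _ _ he, (inr_mem_con hG).2 ⟨h ⟨x, he⟩, .refl⟩⟩

namespace Proper

theorem mono (hM : Proper M) (hB : ∀ x, Closed (B x)) (h : B ≤ M) : Proper B where
  closed := hB
  unique a x y hx hy := hM.unique a x y (h x hx) (h y hy)

theorem image (hM : Proper M) {f : X → Y} (hf : f.Injective) : Proper (mapMarking f M) where
  closed x := (hM.closed x).image f
  unique _ x y h h' := by
    obtain ⟨a, rfl, ha⟩ := Item.inl_mem_image.1 h
    exact hM.unique a x y ha ((Item.map_injective hf).mem_set_image.1 h')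

theorem closed_total (hM : Proper M) : Closed (total M) := MultiRPN.closed_total hM.closed

theorem mem_of_mem_total (hM : Proper M) (h : B ≤ M) {a : X} {x : P}
    (ha : Sum.inl a ∈ total B) (hx : Sum.inl a ∈ M x) : Sum.inl a ∈ B x := by
  obtain ⟨y, hy⟩ := ha
  exact hM.unique a y x (h y hy) hx ▸ hy

theorem bond_mem (hM : Proper M) {x : P} {a b : X} (ha : Sum.inl a ∈ M x)
    (hab : Sum.inr s(a, b) ∈ total M) : Sum.inr s(a, b) ∈ M x := by
  obtain ⟨y, hy⟩ := hab
  exact hM.unique a y x (hM.closed y _ _ hy) ha ▸ hy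

theorem con_total (hM : Proper M) {x : P} {a : X} (ha : Sum.inl a ∈ M x) :
    con a (total M) = con a (M x) :=
  con_eq_of_saturated (hM.closed x) (subset_total M x) (fun _ _ => hM.bond_mem) ha

theorem eq_of_conn (hM : Proper M) {x y : P} {a b : X} (ha : Sum.inl a ∈ M x)
    (hb : Sum.inl b ∈ M y) (h : Conn (total M) a b) : x = y := by
  have hcon : Sum.inl b ∈ con a (total M) := inl_mem_con.2 ⟨⟨y, hb⟩, h⟩
  rw [hM.con_total ha] at hcon
  exact hM.unique b x y (con_subset hcon) hb

end Proper

/-- `M` is the union of two markings without a common token, hence without bonds between them. -/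
structure Splits (M B E : P → Set (Item X)) : Prop where
  eq_sup : M = B ⊔ E
  left : Proper B
  right : Proper E
  apart : ∀ a, Sum.inl a ∈ total B → Sum.inl a ∉ total E

namespace Splits

theorem symm (h : Splits M B E) : Splits M E B :=
  ⟨h.eq_sup.trans (sup_comm ..), h.right, h.left, fun a hE hB => h.apart a hB hE⟩

theorem le (h : Splits M B E) : B ≤ M := h.eq_sup ▸ le_sup_left

theorem total_eq (h : Splits M B E) : total M = total B ∪ total E := by rw [h.eq_sup, total_sup]

theorem proper (h : Splits M B E) : Proper M where
  closed x := by
    rw [h.eq_sup]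
    rintro a b (hab | hab)
    exacts [Or.inl (h.left.closed x _ _ hab), Or.inr (h.right.closed x _ _ hab)]
  unique a x y hx hy := by
    rw [h.eq_sup] at hx hy
    rcases hx with hx | hx <;> rcases hy with hy | hy
    exacts [h.left.unique a x y hx hy, absurd ⟨y, hy⟩ (h.apart a ⟨x, hx⟩),
      absurd ⟨x, hx⟩ (h.apart a ⟨y, hy⟩), h.right.unique a x y hx hy]

theorem disjoint (h : Splits M B E) : Disjoint (total B) (total E) := by
  rw [Set.disjoint_left]
  rintro (a | ⟨a, b⟩) hB hE
  · exact h.apart a hB hE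
  · exact h.apart a (h.left.closed_total _ _ hB) (h.right.closed_total _ _ hE)

theorem con_eq (h : Splits M B E) {a : X} (ha : Sum.inl a ∈ total B) :
    con a (total M) = con a (total B) := by
  refine con_eq_of_saturated h.left.closed_total (total_mono h.le) (fun b c hb hbc => ?_) ha
  rw [h.total_eq] at hbc
  exact hbc.resolve_right fun hE => h.apart b hb (h.right.closed_total _ _ hE)

theorem gather_eq (h : Splits M B E) {L : P → Set (Item X)} (hL : L ≤ B) :
    gather (total M) L = gather (total B) L := by
  ext x e
  exact exists_congr fun c => and_congr_right fun hc => by rw [h.con_eq ⟨x, hL x hc⟩]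

theorem sdiff_eq (h : Splits M B E) (x : P) : M x \ B x = E x := by
  rw [h.eq_sup]
  exact Set.union_sdiff_cancel_left (h.disjoint.mono (subset_total B x) (subset_total E x)).le_bot

theorem right_unique {E' : P → Set (Item X)} (h : Splits M B E) (h' : Splits M B E') : E = E' :=
  funext fun x => (h.sdiff_eq x).symm.trans (h'.sdiff_eq x)

theorem image {f : X → Y} (hf : f.Injective) (h : Splits M B E) :
    Splits (mapMarking f M) (mapMarking f B) (mapMarking f E) where
  eq_sup := by rw [h.eq_sup, mapMarking_sup]
  left := h.left.image hf
  right := h.right.image hf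
  apart b hB hE := by
    rw [total_mapMarking] at hB hE
    obtain ⟨a, rfl, ha⟩ := Item.inl_mem_image.1 hB
    exact h.apart a ha ((Item.map_injective hf).mem_set_image.1 hE)

theorem sup_of_le {E' : P → Set (Item X)} (h : Splits M B E) (hE' : Proper E') (hle : E' ≤ E) :
    Splits (B ⊔ E') B E' :=
  ⟨rfl, h.left, hE', fun a hB h' => h.apart a hB (total_mono hle h')⟩

theorem left_comm {B' E' : P → Set (Item X)} (h : Splits M B E) (h' : Splits E B' E') :
    Splits M B' (B ⊔ E') where
  eq_sup := by rw [h.eq_sup, h'.eq_sup, sup_left_comm]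
  left := h'.left
  right := (h.sup_of_le h'.right h'.symm.le).proper
  apart a hB' ha := by
    rw [total_sup] at ha
    exact ha.elim (fun hB => h.apart a hB (total_mono h'.le hB')) (h'.apart a hB')

theorem inf_of_apart {B' E' : P → Set (Item X)} (h : Splits M B E) (h' : Splits M B' E')
    (apart : ∀ a, Sum.inl a ∈ total B' → Sum.inl a ∉ total B) : Splits E B' (E ⊓ E') where
  eq_sup := by
    have hle : B' ≤ E := by
      intro x e he
      have hM := h'.le x he
      rw [h.eq_sup] at hM
      refine hM.resolve_left fun hB => ?_
      rcases e with a | ⟨a, b⟩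
      · exact apart a ⟨x, he⟩ ⟨x, hB⟩
      · exact apart a ⟨x, h'.left.closed x _ _ he⟩ ⟨x, h.left.closed x _ _ hB⟩
    calc E = E ⊓ (B' ⊔ E') := by rw [← h'.eq_sup, inf_eq_left.2 h.symm.le]
      _ = B' ⊔ (E ⊓ E') := by rw [inf_sup_left, inf_eq_right.2 hle]
  left := h'.left
  right := h.right.mono
    (fun x a b hab => ⟨h.right.closed x a b hab.1, h'.right.closed x a b hab.2⟩) inf_le_left
  apart a hB' ha := h'.apart a hB' (total_mono inf_le_right ha)

end Splits

theorem Proper.splits_gather (hM : Proper M) (hI : I ≤ M) :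
    Splits M (gather (total M) I) (M \ gather (total M) I) := by
  have hle : gather (total M) I ≤ M := by
    rintro x e ⟨c, hc, he⟩
    rw [hM.con_total (hI x hc)] at he
    exact con_subset he
  have proper : Proper (gather (total M) I) :=
    hM.mono (closed_gather hM.closed_total I) hle
  refine ⟨(sup_sdiff_cancel_right hle).symm, proper, hM.mono ?_ sdiff_le, ?_⟩
  · rintro x a b ⟨hab, hn⟩
    refine ⟨hM.closed x _ _ hab, ?_⟩
    rintro ⟨c, hc, hca⟩
    exact hn ⟨c, hc, (inr_mem_con hM.closed_total).2 ⟨⟨x, hab⟩, (inl_mem_con.1 hca).2⟩⟩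
  · rintro a ha ⟨x, hx, hn⟩
    exact hn (hM.mem_of_mem_total hle ha hx)

/-- Replacing the items of `I` by those of `O` turns the marking `B` into `C`, where `B` consists
of the components of the tokens of `I`, and `C` of the components of the tokens of `O`. The
conditions are symmetric, so that going back from `C` to `B` is an instance of the same notion. -/
structure Rearranges (I O B C : P → Set (Item X)) : Prop where
  left : Proper B
  right : Proper C
  closed_in : ∀ x, Closed (I x)
  closed_out : ∀ x, Closed (O x)
  in_le : I ≤ B
  out_le : O ≤ C
  tok_iff : ∀ a, Sum.inl a ∈ total I ↔ Sum.inl a ∈ total O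
  splice_eq : splice (total B) (total I) (total O) = total C
  splice_eq' : splice (total C) (total O) (total I) = total B
  gather_in : gather (total B) I = B
  gather_out : gather (total C) O = C

/-- The items of `I` lie in `M`, and replacing them by those of `O` does not connect tokens with
different destinations. As in the firing rule of a net, connections are only considered within a
place of `M`. -/
structure Replaceable (M I O : P → Set (Item X)) : Prop where
  proper : Proper M
  closed_out : ∀ x, Closed (O x)
  in_le : I ≤ M
  tok_iff : ∀ a, Sum.inl a ∈ total I ↔ Sum.inl a ∈ total O
  noClone : ∀ x y z a b, Sum.inl a ∈ O y → Sum.inl a ∈ M x → Sum.inl b ∈ O z →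
    Conn (splice (M x) (total I) (total O)) a b → y = z

/-- The components of the tokens of `I`, found within the places of `M`. -/
def removed (M I : P → Set (Item X)) (x : P) : Set (Item X) :=
  {e | ∃ c, Sum.inl c ∈ I x ∧ e ∈ con c (M x)}

/-- The components of the tokens of `O` after replacing `I` by `O` within the places of `M`, each
sent to the place where `O` has that token. -/
def delivered (M I O : P → Set (Item X)) (y : P) : Set (Item X) :=
  {e | ∃ c x, Sum.inl c ∈ O y ∧ Sum.inl c ∈ M x ∧
    e ∈ con c (splice (M x) (total I) (total O))}

theorem Proper.removed_eq (hM : Proper M) (hI : I ≤ M) : removed M I = gather (total M) I := by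
  ext x e
  exact exists_congr fun c => and_congr_right fun hc => by rw [hM.con_total (hI x hc)]

namespace Replaceable

theorem exists_mem (h : Replaceable M I O) {y : P} {c : X} (hc : Sum.inl c ∈ O y) :
    ∃ x, Sum.inl c ∈ M x :=
  have ⟨x, hx⟩ := (h.tok_iff c).2 ⟨y, hc⟩
  ⟨x, h.in_le x hx⟩

theorem closed_splice (h : Replaceable M I O) :
    Closed (splice (total M) (total I) (total O)) :=
  MultiRPN.closed_splice h.proper.closed_total (closed_total h.closed_out)
    fun a => (h.tok_iff a).1

/-- Whenever a path leaves a place of `M`, it does so at a token of `O`, with the same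
destination by `noClone`; the path can be restarted from there. -/
theorem exists_conn_place (h : Replaceable M I O) {y : P} {c b : X} (hc : Sum.inl c ∈ O y)
    (hb : Conn (splice (total M) (total I) (total O)) c b) :
    ∃ c' x, Sum.inl c' ∈ O y ∧ Sum.inl c' ∈ M x ∧
      Conn (splice (M x) (total I) (total O)) c' b := by
  have restart : ∀ c, Sum.inl c ∈ O y → ∃ c' x, Sum.inl c' ∈ O y ∧ Sum.inl c' ∈ M x ∧
      Conn (splice (M x) (total I) (total O)) c' c := fun c hc =>
    have ⟨x, hx⟩ := h.exists_mem hc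
    ⟨c, x, hc, hx, .refl⟩
  induction hb with
  | refl => exact restart c hc
  | @tail b d _ hl ih =>
    obtain ⟨c', x, hc', hx, hconn⟩ := ih
    rcases hl.1 with ⟨⟨x', hx'⟩, hI⟩ | ⟨y', hy'⟩
    · have hb' := h.proper.closed x' _ _ hx'
      have link : Linked (splice (M x') (total I) (total O)) b d :=
        ⟨Or.inl ⟨hx', hI⟩, inl_mem_splice (h.tok_iff d).1 ((h.proper.closed x').right hx')⟩
      rcases Conn.mem hconn (inl_mem_splice (h.tok_iff c').1 hx) with ⟨hb, -⟩ | ⟨y', hy'⟩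
      · cases h.proper.unique b x x' hb hb'
        exact ⟨c', x, hc', hx, hconn.tail link⟩
      · cases h.noClone x y y' c' b hc' hx hy' hconn
        exact ⟨b, x', hy', hb', .single link⟩
    · cases h.noClone x y y' c' b hc' hx (h.closed_out y' _ _ hy') hconn
      exact restart d ((h.closed_out _).right hy')

theorem noClone_total (h : Replaceable M I O) {y z : P} {a b : X} (ha : Sum.inl a ∈ O y)
    (hb : Sum.inl b ∈ O z) (hab : Conn (splice (total M) (total I) (total O)) a b) : y = z :=
  have ⟨_, x, hc, hx, hcb⟩ := h.exists_conn_place ha hab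
  h.noClone x y z _ b hc hx hb hcb

theorem delivered_eq (h : Replaceable M I O) :
    delivered M I O = gather (splice (total M) (total I) (total O)) O := by
  have token_mem : ∀ y c b, Sum.inl c ∈ O y →
      Conn (splice (total M) (total I) (total O)) c b →
      ∃ c' x, Sum.inl c' ∈ O y ∧ Sum.inl c' ∈ M x ∧ Sum.inl b ∈ M x ∧
        Conn (splice (M x) (total I) (total O)) c' b := by
    intro y c b hc hcb
    obtain ⟨c', x, hc', hx, hconn⟩ := h.exists_conn_place hc hcb
    by_cases hbO : Sum.inl b ∈ total O
    · obtain ⟨z, hz⟩ := hbO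
      cases h.noClone_total hc hz hcb
      obtain ⟨w, hw⟩ := h.exists_mem hz
      exact ⟨b, w, hz, hw, hw, .refl⟩
    · have hbx := Conn.mem hconn (inl_mem_splice (h.tok_iff c').1 hx)
      exact ⟨c', x, hc', hx, (hbx.resolve_right hbO).1, hconn⟩
  funext y
  apply Set.Subset.antisymm
  · rintro e ⟨c, x, hc, -, he⟩
    exact ⟨c, hc, con_mono (splice_mono_left (subset_total M x) _ _) c he⟩
  · rintro (b | ⟨b, d⟩) ⟨c, hc, he⟩
    · rw [inl_mem_con] at he
      obtain ⟨c', x, hc', hx, hb, hconn⟩ := token_mem y c b hc he.2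
      exact ⟨c', x, hc', hx, inl_mem_con.2 ⟨inl_mem_splice (h.tok_iff b).1 hb, hconn⟩⟩
    · rw [inr_mem_con h.closed_splice] at he
      obtain ⟨c', x, hc', hx, hb, hconn⟩ := token_mem y c b hc he.2
      have hbd : Sum.inr s(b, d) ∈ splice (M x) (total I) (total O) :=
        he.1.imp (fun h' => ⟨h.proper.bond_mem hb h'.1, h'.2⟩) id
      have closed : Closed (splice (M x) (total I) (total O)) :=
        MultiRPN.closed_splice (h.proper.closed x) (closed_total h.closed_out)
          fun a => (h.tok_iff a).1
      exact ⟨c', x, hc', hx, (inr_mem_con closed).2 ⟨hbd, hconn⟩⟩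

end Replaceable

namespace Rearranges

theorem symm (h : Rearranges I O B C) : Rearranges O I C B where
  left := h.right
  right := h.left
  closed_in := h.closed_out
  closed_out := h.closed_in
  in_le := h.out_le
  out_le := h.in_le
  tok_iff a := (h.tok_iff a).symm
  splice_eq := h.splice_eq'
  splice_eq' := h.splice_eq
  gather_in := h.gather_out
  gather_out := h.gather_in

theorem image (h : Rearranges I O B C) {f : X → Y} (hf : f.Injective) :
    Rearranges (mapMarking f I) (mapMarking f O) (mapMarking f B) (mapMarking f C) where
  left := h.left.image hf
  right := h.right.image hf
  closed_in x := (h.closed_in x).image f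
  closed_out x := (h.closed_out x).image f
  in_le x := Set.image_mono (h.in_le x)
  out_le x := Set.image_mono (h.out_le x)
  tok_iff a := by simp only [total_mapMarking, Item.inl_mem_image, h.tok_iff]
  splice_eq := by simp only [total_mapMarking, splice_image hf, h.splice_eq]
  splice_eq' := by simp only [total_mapMarking, splice_image hf, h.splice_eq']
  gather_in := by rw [total_mapMarking, gather_mapMarking hf, h.gather_in]
  gather_out := by rw [total_mapMarking, gather_mapMarking hf, h.gather_out]

theorem mem_right (h : Rearranges I O B C) {a : X} (ha : Sum.inl a ∈ total B) :
    Sum.inl a ∈ total C :=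
  h.splice_eq ▸ inl_mem_splice (h.tok_iff a).1 ha

theorem splits (h : Rearranges I O B C) (hM : Splits M B E) : Splits (C ⊔ E) C E :=
  ⟨rfl, h.right, hM.right, fun a ha => hM.apart a (h.symm.mem_right ha)⟩

theorem splice_total (h : Rearranges I O B C) (hM : Splits M B E) :
    splice (total M) (total I) (total O) = total (C ⊔ E) := by
  have hE : total E \ total I = total E :=
    sdiff_eq_left.2 (hM.disjoint.symm.mono_right (total_mono h.in_le))
  rw [total_sup, ← h.splice_eq, hM.total_eq, splice, splice, Set.union_sdiff_distrib, hE,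
    Set.union_right_comm]

theorem noClone (h : Rearranges I O B C) (hM : Splits M B E) {y z : P} {a b : X}
    (ha : Sum.inl a ∈ O y) (hb : Sum.inl b ∈ O z)
    (hab : Conn (splice (total M) (total I) (total O)) a b) : y = z := by
  rw [h.splice_total hM] at hab
  exact (h.splits hM).proper.eq_of_conn (Or.inl (h.out_le y ha)) (Or.inl (h.out_le z hb)) hab

theorem replaceable (h : Rearranges I O B C) (hM : Splits M B E) : Replaceable M I O where
  proper := hM.proper
  closed_out := h.closed_out
  in_le := h.in_le.trans hM.le
  tok_iff := h.tok_iff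
  noClone x _ _ _ _ ha _ hb hab :=
    h.noClone hM ha hb (Conn.mono (splice_mono_left (subset_total M x) _ _) hab)

theorem removed_eq (h : Rearranges I O B C) (hM : Splits M B E) : removed M I = B := by
  rw [hM.proper.removed_eq (h.in_le.trans hM.le), hM.gather_eq h.in_le, h.gather_in]

theorem delivered_eq (h : Rearranges I O B C) (hM : Splits M B E) : delivered M I O = C := by
  rw [(h.replaceable hM).delivered_eq, h.splice_total hM, (h.splits hM).gather_eq h.out_le,
    h.gather_out]

theorem sdiff_removed (h : Rearranges I O B C) (hM : Splits M B E) (x : P) :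
    M x \ removed M I x = E x := by
  rw [h.removed_eq hM, hM.sdiff_eq]

theorem eq_of_splits {B' C' E' : P → Set (Item X)} (h : Rearranges I O B C)
    (h' : Rearranges I O B' C') (hM : Splits M B E) (hM' : Splits M B' E') :
    B = B' ∧ C = C' ∧ E = E' := by
  obtain rfl := (h.removed_eq hM).symm.trans (h'.removed_eq hM')
  exact ⟨rfl, (h.delivered_eq hM).symm.trans (h'.delivered_eq hM'), hM.right_unique hM'⟩

end Rearranges

/-- A path of old bonds starting at a token of `I` is a path of new bonds except where it uses a
bond of `I`, between tokens of `O`. -/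
theorem exists_conn_out {G I O : Set (Item X)} (hI : Closed I)
    (tok : ∀ a, Sum.inl a ∈ I → Sum.inl a ∈ O) {a b : X} (ha : Sum.inl a ∈ I)
    (hab : Conn G a b) : ∃ c, Sum.inl c ∈ O ∧ Conn (splice G I O) c b := by
  induction hab with
  | refl => exact ⟨a, tok a ha, .refl⟩
  | @tail b d _ hl ih =>
    by_cases hbd : Sum.inr s(b, d) ∈ I
    · exact ⟨d, tok d (hI.right hbd), .refl⟩
    · obtain ⟨c, hc, hcb⟩ := ih
      exact ⟨c, hc, hcb.tail ⟨Or.inl ⟨hl.1, hbd⟩, inl_mem_splice (tok d) hl.2⟩⟩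

theorem total_gather_splice (hB : Closed (total B)) (hI : ∀ x, Closed (I x))
    (hO : ∀ x, Closed (O x)) (gather_in : gather (total B) I = B)
    (tok : ∀ a, Sum.inl a ∈ total I → Sum.inl a ∈ total O) :
    total (gather (splice (total B) (total I) (total O)) O) =
      splice (total B) (total I) (total O) := by
  have closed := closed_splice hB (closed_total hO) tok
  have exists_conn : ∀ b, Sum.inl b ∈ splice (total B) (total I) (total O) →
      ∃ c, Sum.inl c ∈ total O ∧ Conn (splice (total B) (total I) (total O)) c b := by
    rintro b (⟨⟨x, hx⟩, -⟩ | hb)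
    · rw [← gather_in] at hx
      obtain ⟨c, hc, hcb⟩ := hx
      exact exists_conn_out (closed_total hI) tok ⟨x, hc⟩ (inl_mem_con.1 hcb).2
    · exact ⟨b, hb, .refl⟩
  apply Set.Subset.antisymm
  · rintro e ⟨x, c, -, he⟩
    exact con_subset he
  · rintro (b | ⟨b, d⟩) he
    · obtain ⟨c, ⟨y, hc⟩, hcb⟩ := exists_conn b he
      exact ⟨y, c, hc, inl_mem_con.2 ⟨he, hcb⟩⟩
    · obtain ⟨c, ⟨y, hc⟩, hcb⟩ := exists_conn b (closed _ _ he)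
      exact ⟨y, c, hc, (inr_mem_con closed).2 ⟨he, hcb⟩⟩

theorem Proper.gather {G : Set (Item X)} {L : P → Set (Item X)} (hG : Closed G)
    (noClone : ∀ y z a b, Sum.inl a ∈ L y → Sum.inl b ∈ L z → Conn G a b → y = z) :
    Proper (gather G L) where
  closed := closed_gather hG L
  unique := by
    rintro a x y ⟨c, hc, hca⟩ ⟨d, hd, hda⟩
    exact noClone x y c d hc hd
      ((inl_mem_con.1 hca).2.trans (Conn.symm hG (inl_mem_con.1 hda).2))

theorem Replaceable.exists_rearranges (h : Replaceable M I O) (closed_in : ∀ x, Closed (I x))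
    (noRecreate : ∀ a b, Sum.inl a ∈ total I → Sum.inl b ∈ total I →
      Sum.inr s(a, b) ∈ total M → Sum.inr s(a, b) ∈ total I) :
    ∃ B C E, Rearranges I O B C ∧ Splits M B E := by
  have hM := h.proper.splits_gather h.in_le
  set B := gather (total M) I
  have in_le : I ≤ B := le_gather h.proper.closed_total closed_in (total_mono h.in_le)
  have gather_in : gather (total B) I = B := (hM.gather_eq in_le).symm
  have closed := MultiRPN.closed_splice hM.left.closed_total (closed_total h.closed_out)
    fun a => (h.tok_iff a).1
  have total_eq := total_gather_splice hM.left.closed_total closed_in h.closed_out gather_in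
    fun a => (h.tok_iff a).1
  have inter_out : total B ∩ total O ⊆ total I := by
    rintro (a | ⟨a, b⟩) ⟨hB, hO⟩
    · exact (h.tok_iff a).2 hO
    · have hO' := closed_total h.closed_out
      exact noRecreate a b ((h.tok_iff a).2 (hO' _ _ hO)) ((h.tok_iff b).2 (hO'.right hO))
        (total_mono hM.le hB)
  refine ⟨B, gather (splice (total B) (total I) (total O)) O, _, ⟨hM.left, ?_, closed_in,
    h.closed_out, in_le, le_gather closed h.closed_out Set.subset_union_right, h.tok_iff,
    total_eq.symm, ?_, gather_in, by rw [total_eq]⟩, hM⟩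
  · exact .gather closed fun y z a b ha hb hab =>
      h.noClone_total ha hb (Conn.mono (splice_mono_left (total_mono hM.le) _ _) hab)
  · rw [total_eq, splice_splice (total_mono in_le) inter_out]

end Markings

section Keys
variable {A V : Type*}

namespace Tok

/-- The keys in the memory of an instance. -/
def keys : Tok A V → Set ℕ
  | base _ _ => ∅
  | mem b k _ => insert k b.keys

/-- Later memories of an instance have larger keys. -/
def Sorted : Tok A V → Prop
  | base _ _ => True
  | mem b k _ => b.Sorted ∧ ∀ k' ∈ b.keys, k' < k

theorem mem_keys_iff {a : Tok A V} {k : ℕ} :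
    k ∈ a.keys ↔ ∃ b u, EvolvedTo (mem b k u) a := by
  constructor
  · intro h
    induction a with
    | base => exact absurd h (Set.notMem_empty _)
    | mem b k' u ih =>
      rcases h with rfl | h
      · exact ⟨b, u, .refl⟩
      · obtain ⟨c, v, h'⟩ := ih h
        exact ⟨c, v, h'.mem _ _⟩
  · rintro ⟨b, u, h⟩
    induction h with
    | refl => exact Or.inl rfl
    | mem _ _ _ ih => exact Or.inr ih

theorem rekey_injective {φ : ℕ → ℕ} (hφ : φ.Injective) :
    (rekey φ : Tok A V → Tok A V).Injective := by
  intro a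
  induction a with
  | base a i => rintro (_ | _) h <;> cases h; rfl
  | mem b k u ih =>
    rintro (_ | ⟨c, l, v⟩) h
    · cases h
    · obtain ⟨hb, hk, rfl⟩ := mem.inj h
      rw [ih hb, hφ hk]

theorem keys_rekey (φ : ℕ → ℕ) (a : Tok A V) : (a.rekey φ).keys = φ '' a.keys := by
  induction a with
  | base => exact (Set.image_empty _).symm
  | mem b k u ih => simp only [rekey, keys, ih, Set.image_insert_eq]

theorem rekey_rekey (φ ψ : ℕ → ℕ) (a : Tok A V) :
    (a.rekey φ).rekey ψ = a.rekey fun k => ψ (φ k) := by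
  induction a with
  | base => rfl
  | mem b k u ih => simp only [rekey, ih]

theorem origin_rekey (φ : ℕ → ℕ) (a : Tok A V) : (a.rekey φ).origin = a.origin := by
  induction a with
  | base => rfl
  | mem _ _ _ ih => exact ih

theorem ty_rekey (φ : ℕ → ℕ) (a : Tok A V) : (a.rekey φ).ty = a.ty := by
  induction a with
  | base => rfl
  | mem _ _ _ ih => exact ih

theorem rekey_congr {φ ψ : ℕ → ℕ} {a : Tok A V} (h : ∀ k ∈ a.keys, φ k = ψ k) :
    a.rekey φ = a.rekey ψ := by
  induction a with
  | base => rfl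
  | mem b k u ih =>
    simp only [rekey, h k (Or.inl rfl), ih fun k hk => h k (Or.inr hk)]

theorem rekey_id (a : Tok A V) : a.rekey (fun k => k) = a := by
  induction a with
  | base => rfl
  | mem b k u ih => simp only [rekey, ih]

theorem Sorted.lt_of_lt {a : Tok A V} {φ : ℕ → ℕ} (ha : a.Sorted) (hφ : (a.rekey φ).Sorted)
    {k l : ℕ} (hk : k ∈ a.keys) (hl : l ∈ a.keys) (hkl : k < l) : φ k < φ l := by
  induction a with
  | base => exact absurd hk (Set.notMem_empty _)
  | mem b m u ih =>
    rcases hl with rfl | hl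
    · rcases hk with rfl | hk
      · exact absurd hkl (lt_irrefl _)
      · exact hφ.2 _ (by rw [keys_rekey]; exact ⟨k, hk, rfl⟩)
    · rcases hk with rfl | hk
      · exact absurd (ha.2 _ hl) hkl.asymm
      · exact ih ha.1 hφ.1 hk hl

end Tok

namespace State
variable {P T : Type*}

/-- Rename the keys of a state. -/
def rekey (φ : Equiv.Perm ℕ) (S : State P T A V) : State P T A V where
  M := mapMarking (Tok.rekey φ) S.M
  H t := φ '' S.H t

theorem rekey_rekey (φ ψ : Equiv.Perm ℕ) (S : State P T A V) :
    (S.rekey φ).rekey ψ = S.rekey (φ.trans ψ) :=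
  State.ext (by simp only [rekey, mapMarking_mapMarking, Tok.rekey_rekey, Equiv.coe_trans,
      Function.comp_def])
    (by simp only [rekey, Set.image_image, Equiv.coe_trans, Function.comp_def])

theorem rekey_refl (S : State P T A V) : S.rekey (Equiv.refl ℕ) = S :=
  State.ext ((congrArg (mapMarking · S.M) (funext Tok.rekey_id)).trans (mapMarking_id S.M))
    (funext fun t => Set.image_id (S.H t))

theorem rekey_rekey_symm (φ : Equiv.Perm ℕ) (S : State P T A V) :
    (S.rekey φ).rekey φ.symm = S := by
  rw [rekey_rekey, Equiv.self_trans_symm, rekey_refl]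

theorem rekey_congr {S : State P T A V} {φ ψ : Equiv.Perm ℕ} (hS : Proper S.M)
    (hM : ∀ a, Sum.inl a ∈ total S.M → ∀ k ∈ a.keys, φ k = ψ k)
    (hH : ∀ t, φ '' S.H t = ψ '' S.H t) : S.rekey φ = S.rekey ψ :=
  State.ext (mapMarking_congr hS.closed fun x a ha => Tok.rekey_congr (hM a ⟨x, ha⟩)) (funext hH)

theorem markEquiv_iff {S S' : State P T A V} :
    MRPN.MarkEquiv S S' ↔ ∃ φ, S' = S.rekey φ := by
  refine exists_congr fun φ => ⟨fun ⟨hist, marking⟩ => ?_, ?_⟩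
  · refine State.ext (funext marking) (funext fun t => Set.ext fun k => ?_)
    change k ∈ S'.H t ↔ k ∈ φ '' S.H t
    rw [Equiv.image_eq_preimage_symm, Set.mem_preimage, hist, Equiv.apply_symm_apply]
  · rintro rfl
    exact ⟨fun t k => φ.injective.mem_set_image.symm, fun x => rfl⟩

end State

end Keys

namespace MRPN
variable {P T A V : Type*} (N : MRPN P T A V) {S : State P T A V} {t : T} {k : ℕ}
  {U : V → Tok A V}

/-- Transitions neither erase nor create tokens. -/
def Conservative : Prop := ∀ t, N.guardVars t = N.effectVars t

/-- The items required on the incoming arcs of `t` under the assignment `U`, by places. -/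
def inItems (t : T) (U : V → Tok A V) : P → Set (Item (Tok A V)) :=
  mapMarking U fun x => N.inArc x t

/-- The items on the outgoing arcs of `t` under the assignment `U`, by places. -/
def outItems (t : T) (U : V → Tok A V) : P → Set (Item (Tok A V)) :=
  mapMarking U (N.outArc t)

theorem preItems_eq (t : T) (U : V → Tok A V) : N.preItems t U = total (N.inItems t U) := by
  ext e
  simp only [preItems, total, inItems, mapMarking, Set.mem_image, Set.mem_ofPred_eq, eq_comm]

theorem postItems_eq (t : T) (U : V → Tok A V) : N.postItems t U = total (N.outItems t U) := by
  ext e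
  simp only [postItems, total, outItems, mapMarking, Set.mem_image, Set.mem_ofPred_eq, eq_comm]

theorem inItems_map (f : Tok A V → Tok A V) (t : T) (U : V → Tok A V) :
    N.inItems t (fun u => f (U u)) = mapMarking f (N.inItems t U) :=
  (mapMarking_mapMarking f U _).symm

theorem outItems_map (f : Tok A V → Tok A V) (t : T) (U : V → Tok A V) :
    N.outItems t (fun u => f (U u)) = mapMarking f (N.outItems t U) :=
  (mapMarking_mapMarking f U _).symm

theorem closed_inArc (x : P) (t : T) : Closed (N.inArc x t) :=
  fun u v h => (N.inArc_bond x t u v h).1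

theorem closed_outArc (t : T) (x : P) : Closed (N.outArc t x) :=
  fun u v h => (N.outArc_bond t x u v h).1

theorem closed_inItems (t : T) (U : V → Tok A V) (x : P) : Closed (N.inItems t U x) :=
  (N.closed_inArc x t).image U

theorem closed_outItems (t : T) (U : V → Tok A V) (x : P) : Closed (N.outItems t U x) :=
  (N.closed_outArc t x).image U

variable {N}

theorem inItems_congr {U' : V → Tok A V} (h : ∀ u ∈ N.guardVars t, U u = U' u) :
    N.inItems t U = N.inItems t U' :=
  mapMarking_congr (fun x => N.closed_inArc x t) fun x u hu => h u ⟨x, hu⟩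

theorem outItems_congr {U' : V → Tok A V} (h : ∀ u ∈ N.effectVars t, U u = U' u) :
    N.outItems t U = N.outItems t U' :=
  mapMarking_congr (N.closed_outArc t) fun x u hu => h u ⟨x, hu⟩

theorem inl_mem_inItems {x : P} {a : Tok A V} :
    Sum.inl a ∈ N.inItems t U x ↔ ∃ u, a = U u ∧ Sum.inl u ∈ N.inArc x t :=
  Item.inl_mem_image

theorem inl_mem_outItems {x : P} {a : Tok A V} :
    Sum.inl a ∈ N.outItems t U x ↔ ∃ u, a = U u ∧ Sum.inl u ∈ N.outArc t x :=
  Item.inl_mem_image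

theorem inl_mem_total_inItems {a : Tok A V} :
    Sum.inl a ∈ total (N.inItems t U) ↔ ∃ u ∈ N.guardVars t, a = U u := by
  constructor
  · rintro ⟨x, hx⟩
    obtain ⟨u, rfl, hu⟩ := inl_mem_inItems.1 hx
    exact ⟨u, ⟨x, hu⟩, rfl⟩
  · rintro ⟨u, ⟨x, hu⟩, rfl⟩
    exact ⟨x, inl_mem_inItems.2 ⟨u, rfl, hu⟩⟩

theorem inl_mem_total_outItems {a : Tok A V} :
    Sum.inl a ∈ total (N.outItems t U) ↔ ∃ u ∈ N.effectVars t, a = U u := by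
  constructor
  · rintro ⟨x, hx⟩
    obtain ⟨u, rfl, hu⟩ := inl_mem_outItems.1 hx
    exact ⟨u, ⟨x, hu⟩, rfl⟩
  · rintro ⟨u, ⟨x, hu⟩, rfl⟩
    exact ⟨x, inl_mem_outItems.2 ⟨u, rfl, hu⟩⟩

theorem fwdIn_eq : N.fwdIn S t U = removed S.M (N.inItems t U) := by
  ext x e
  simp only [fwdIn, removed, inl_mem_inItems, Set.mem_ofPred_eq]
  exact ⟨fun ⟨u, hu, he⟩ => ⟨_, ⟨u, rfl, hu⟩, he⟩, fun ⟨_, ⟨u, h, hu⟩, he⟩ => ⟨u, hu, h ▸ he⟩⟩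

theorem revIn_eq : N.revIn S t U = removed S.M (N.outItems t U) := by
  ext x e
  simp only [revIn, removed, inl_mem_outItems, Set.mem_ofPred_eq]
  exact ⟨fun ⟨u, hu, he⟩ => ⟨_, ⟨u, rfl, hu⟩, he⟩, fun ⟨_, ⟨u, h, hu⟩, he⟩ => ⟨u, hu, h ▸ he⟩⟩

theorem fwdOut_eq : N.fwdOut S t U = delivered S.M (N.inItems t U) (N.outItems t U) := by
  ext y e
  simp only [fwdOut, delivered, inl_mem_outItems, Set.mem_ofPred_eq, preItems_eq, postItems_eq]
  exact ⟨fun ⟨u, x, hu, h⟩ => ⟨_, x, ⟨u, rfl, hu⟩, h⟩,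
    fun ⟨_, x, ⟨u, ha, hu⟩, h⟩ => ⟨u, x, hu, ha ▸ h⟩⟩

theorem revOut_eq : N.revOut S t U = delivered S.M (N.outItems t U) (N.inItems t U) := by
  ext y e
  simp only [revOut, delivered, inl_mem_inItems, Set.mem_ofPred_eq, preItems_eq, postItems_eq]
  exact ⟨fun ⟨u, x, hu, h⟩ => ⟨_, x, ⟨u, rfl, hu⟩, h⟩,
    fun ⟨_, x, ⟨u, ha, hu⟩, h⟩ => ⟨u, x, hu, ha ▸ h⟩⟩

theorem role_congr {U' : V → Tok A V} {a a' : Tok A V}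
    (h : ∀ u ∈ N.guardVars t, U u = a ↔ U' u = a') : N.role t U a = N.role t U' a' := by
  have same : (fun u => u ∈ N.guardVars t ∧ U u = a) = fun u => u ∈ N.guardVars t ∧ U' u = a' :=
    funext fun u => propext (and_congr_right (h u))
  rw [role, role, same]

theorem role_eq_some {a : Tok A V} {u : V} (h : N.role t U a = some u) :
    u ∈ N.guardVars t ∧ U u = a := by
  unfold role at h
  split_ifs at h with hu
  · cases h
    exact hu.choose_spec

theorem role_apply (hU : Set.InjOn U (N.guardVars t)) {u : V} (hu : u ∈ N.guardVars t) :
    N.role t U (U u) = some u := by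
  have h : ∃ v ∈ N.guardVars t, U v = U u := ⟨u, hu, rfl⟩
  rw [role, dif_pos h]
  exact congrArg some (hU h.choose_spec.1 hu h.choose_spec.2)

variable (N) in
/-- The instance `a` with the memory added to it by the occurrence `(t, k)` under `U`. -/
noncomputable def stamp (t : T) (k : ℕ) (U : V → Tok A V) (a : Tok A V) : Tok A V :=
  .mem a k (N.role t U a)

theorem stamp_injective : (N.stamp t k U).Injective :=
  fun _ _ h => (Tok.mem.inj h).1

theorem stamp_congr {U' : V → Tok A V} (h : ∀ u ∈ N.guardVars t, U u = U' u) :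
    N.stamp t k U = N.stamp t k U' :=
  funext fun a => congrArg (Tok.mem a k) (role_congr fun u hu => by rw [h u hu])

end MRPN

/-! ### Steps with fresh keys -/

namespace MRPN
variable {P T A V : Type*} {N : MRPN P T A V} {S S' : State P T A V} {t : T} {k : ℕ}
  {U : V → Tok A V} {B C E : P → Set (Item (Tok A V))}

variable (N) in
/-- Firing `t` with the assignment `U` turns the part `B` of a marking, the components of the
selected tokens, into `C`, before memories are extended. -/
structure Fires (t : T) (U : V → Tok A V) (B C : P → Set (Item (Tok A V))) : Prop where
  inj : Set.InjOn U (N.guardVars t)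
  ty : ∀ u ∈ N.guardVars t, N.varTy u = (U u).ty
  noRecreate : ∀ a b, Sum.inl a ∈ total (N.inItems t U) → Sum.inl b ∈ total (N.inItems t U) →
    Sum.inr s(a, b) ∈ total B → Sum.inr s(a, b) ∈ total (N.inItems t U)
  rearranges : Rearranges (N.inItems t U) (N.outItems t U) B C

theorem FwdEnabled.in_le (h : N.FwdEnabled S t U) : N.inItems t U ≤ S.M := by
  rintro x _ ⟨u | ⟨u, v⟩, hu, rfl⟩
  · exact (h.tokens x u hu).1
  · exact h.bonds x u v hu

theorem FwdEnabled.replaceable (h : N.FwdEnabled S t U) (hN : N.Conservative)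
    (hS : Proper S.M) : Replaceable S.M (N.inItems t U) (N.outItems t U) where
  proper := hS
  closed_out := N.closed_outItems t U
  in_le := h.in_le
  tok_iff a := by rw [inl_mem_total_inItems, inl_mem_total_outItems, hN t]
  noClone x y z a b ha hx hb hab := by
    obtain ⟨u, rfl, hu⟩ := inl_mem_outItems.1 ha
    obtain ⟨v, rfl, hv⟩ := inl_mem_outItems.1 hb
    have guard : Sum.inl (U u) ∈ total (N.inItems t U) :=
      inl_mem_total_inItems.2 ⟨u, hN t ▸ ⟨y, hu⟩, rfl⟩
    have mem : Sum.inl (U u) ∈ N.inItems t U x := hS.mem_of_mem_total h.in_le guard hx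
    by_contra hne
    refine h.noClone v u z y (Ne.symm hne) hv hu x (Set.Nonempty.of_image ⟨_, mem⟩) ?_
    rw [preItems_eq, postItems_eq]
    have out : Sum.inl (U v) ∈ total (N.outItems t U) := ⟨z, hb⟩
    exact inl_mem_con.2 ⟨Or.inr out, hab⟩

theorem FwdEnabled.exists_fires (h : N.FwdEnabled S t U) (hN : N.Conservative)
    (hS : Proper S.M) : ∃ B C E, N.Fires t U B C ∧ Splits S.M B E := by
  have noRecreate : ∀ a b, Sum.inl a ∈ total (N.inItems t U) →
      Sum.inl b ∈ total (N.inItems t U) → Sum.inr s(a, b) ∈ total S.M →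
      Sum.inr s(a, b) ∈ total (N.inItems t U) := by
    rintro a b ha hb ⟨x, hab⟩
    have hax := hS.mem_of_mem_total h.in_le ha (hS.closed x _ _ hab)
    have hbx := hS.mem_of_mem_total h.in_le hb ((hS.closed x).right hab)
    obtain ⟨u, rfl, hu⟩ := inl_mem_inItems.1 hax
    obtain ⟨v, rfl, hv⟩ := inl_mem_inItems.1 hbx
    exact ⟨x, _, h.noRecreate x u v hu hv hab, rfl⟩
  obtain ⟨B, C, E, hBC, hM⟩ :=
    (h.replaceable hN hS).exists_rearranges (N.closed_inItems t U) noRecreate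
  exact ⟨B, C, E, ⟨h.inj, fun u ⟨x, hu⟩ => (h.tokens x u hu).2,
    fun a b ha hb hab => noRecreate a b ha hb (total_mono hM.le hab), hBC⟩, hM⟩

namespace Fires

theorem fwdEnabled (h : N.Fires t U B C) (hM : Splits S.M B E) : N.FwdEnabled S t U where
  inj := h.inj
  tokens x u hu := ⟨hM.le x (h.rearranges.in_le x ⟨_, hu, rfl⟩), h.ty u ⟨x, hu⟩⟩
  bonds x u v huv := hM.le x (h.rearranges.in_le x ⟨_, huv, rfl⟩)
  noRecreate x u v hu hv huv := by
    have hUu : Sum.inl (U u) ∈ N.inItems t U x := ⟨_, hu, rfl⟩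
    have hUv : Sum.inl (U v) ∈ N.inItems t U x := ⟨_, hv, rfl⟩
    have hB := h.rearranges.in_le x hUu
    have bond : Sum.inr s(U u, U v) ∈ B x := by
      rw [hM.eq_sup] at huv
      exact huv.resolve_right fun hE => hM.apart _ ⟨x, hB⟩ ⟨x, hM.right.closed x _ _ hE⟩
    have proper_in := h.rearranges.left.mono h.rearranges.closed_in h.rearranges.in_le
    have bond_in := proper_in.bond_mem hUu
      (h.noRecreate _ _ ⟨x, hUu⟩ ⟨x, hUv⟩ ⟨x, bond⟩)
    obtain ⟨u', v', hu', hv', huv'⟩ := Item.inr_mem_image.1 bond_in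
    cases h.inj ⟨x, hu⟩ ⟨x, N.closed_inArc x t _ _ huv'⟩ hu'
    cases h.inj ⟨x, hv⟩ ⟨x, (N.closed_inArc x t).right huv'⟩ hv'
    exact huv'
  noClone u v y₁ y₂ hne hu hv x _ hcon := by
    rw [preItems_eq, postItems_eq] at hcon
    exact hne (h.rearranges.noClone hM (a := U v) (b := U u) ⟨_, hv, rfl⟩ ⟨_, hu, rfl⟩
      (Conn.mono (splice_mono_left (subset_total S.M x) _ _) (inl_mem_con.1 hcon).2)).symm

theorem token_iff (h : N.Fires t U B C) (hM' : Splits S'.M (mapMarking (N.stamp t k U) C) E)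
    {b : Tok A V} : Sum.inl b ∈ total S'.M ↔
      (∃ a, b = N.stamp t k U a ∧ Sum.inl a ∈ total B) ∨ Sum.inl b ∈ total E := by
  rw [hM'.total_eq, total_mapMarking, Set.mem_union, Item.inl_mem_image]
  exact or_congr_left (exists_congr fun a => and_congr_right fun _ =>
    ⟨h.rearranges.symm.mem_right, h.rearranges.mem_right⟩)

end Fires

/-- Invariants of reachable states: places are disjoint, no two instances have the same origin,
and every key in a memory is in the history, which is finite. -/
structure Inv (S : State P T A V) : Prop where
  proper : Proper S.M
  origin : ∀ a b, Sum.inl a ∈ total S.M → Sum.inl b ∈ total S.M → a.origin = b.origin → a = b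
  keys : ∀ a, Sum.inl a ∈ total S.M → ∀ k ∈ a.keys, ∃ t, k ∈ S.H t
  finite : {k | ∃ t, k ∈ S.H t}.Finite

theorem Initial.inv (h : N.Initial S) : Inv S where
  proper := ⟨fun x a b hb => (h.bond x a b hb).1, h.unique⟩
  origin := by
    rintro a b ⟨x, ha⟩ ⟨y, hb⟩ hab
    obtain ⟨a, i, rfl⟩ := h.base x a ha
    obtain ⟨b, j, rfl⟩ := h.base y b hb
    obtain ⟨rfl, rfl⟩ := Prod.mk.inj hab
    rfl
  keys := by
    rintro a ⟨x, ha⟩ k hk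
    obtain ⟨a, i, rfl⟩ := h.base x a ha
    exact absurd hk (Set.notMem_empty _)
  finite := by simp [h.hist]

theorem Inv.notMem_keys (hS : Inv S) (fresh : ∀ t', k ∉ S.H t') {a : Tok A V}
    (ha : Sum.inl a ∈ total S.M) : k ∉ a.keys := fun hk =>
  have ⟨t', ht'⟩ := hS.keys a ha k hk
  fresh t' ht'

theorem Fires.splits_stamp (h : N.Fires t U B C) (hS : Inv S) (fresh : ∀ t', k ∉ S.H t')
    (hE : Proper E) (hle : E ≤ S.M) :
    Splits (mapMarking (N.stamp t k U) C ⊔ E) (mapMarking (N.stamp t k U) C) E where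
  eq_sup := rfl
  left := h.rearranges.right.image stamp_injective
  right := hE
  apart b hC hb := by
    rw [total_mapMarking] at hC
    obtain ⟨a, rfl, -⟩ := Item.inl_mem_image.1 hC
    exact hS.notMem_keys fresh (total_mono hle hb) (Or.inl rfl)

variable (N) in
/-- A forward step with an arbitrary fresh key, as opposed to the key prescribed by the firing
rule. -/
structure FreshStep (S : State P T A V) (t : T) (k : ℕ) (U : V → Tok A V)
    (S' : State P T A V) : Prop where
  fresh : ∀ t', k ∉ S.H t'
  marking : ∃ B C E, N.Fires t U B C ∧ Splits S.M B E ∧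
    Splits S'.M (mapMarking (N.stamp t k U) C) E
  hist : ∀ t', S'.H t' = {k' | k' ∈ S.H t' ∨ (t' = t ∧ k' = k)}

/-- No memory has been added after a memory with the key `k`. -/
def Outermost (S : State P T A V) (k : ℕ) : Prop :=
  ∀ b l u, Sum.inl (Tok.mem b l u) ∈ total S.M → k ∉ b.keys

namespace FreshStep

theorem hist_subset (h : N.FreshStep S t k U S') {t' : T} {k' : ℕ} (hk : k' ∈ S.H t') :
    k' ∈ S'.H t' := by
  rw [h.hist]; exact Or.inl hk

theorem key_mem (h : N.FreshStep S t k U S') : k ∈ S'.H t := by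
  rw [h.hist]; exact Or.inr ⟨rfl, rfl⟩

theorem persists (h : N.FreshStep S t k U S') {a : Tok A V} (ha : Sum.inl a ∈ total S.M) :
    Sum.inl a ∈ total S'.M ∨ Sum.inl (N.stamp t k U a) ∈ total S'.M := by
  obtain ⟨B, C, E, hF, hM, hM'⟩ := h.marking
  rw [hM.total_eq] at ha
  rw [hF.token_iff hM', hF.token_iff hM']
  exact ha.elim (fun hB => Or.inr (Or.inl ⟨a, rfl, hB⟩)) fun hE => Or.inl (Or.inr hE)

theorem exists_pred (h : N.FreshStep S t k U S') {b : Tok A V} (hb : Sum.inl b ∈ total S'.M) :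
    ∃ a, Sum.inl a ∈ total S.M ∧ (b = a ∨ b = N.stamp t k U a) := by
  obtain ⟨B, C, E, hF, hM, hM'⟩ := h.marking
  rcases (hF.token_iff hM').1 hb with ⟨a, rfl, ha⟩ | hb
  · exact ⟨a, total_mono hM.le ha, Or.inr rfl⟩
  · exact ⟨b, total_mono hM.symm.le hb, Or.inl rfl⟩

theorem new_token (h : N.FreshStep S t k U S') (hS : Inv S) {b : Tok A V}
    (hb : Sum.inl b ∈ total S'.M) (hk : k ∈ b.keys) :
    ∃ a, b = N.stamp t k U a ∧ Sum.inl a ∈ total S.M := by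
  obtain ⟨a, ha, rfl | rfl⟩ := h.exists_pred hb
  · exact absurd hk (hS.notMem_keys h.fresh ha)
  · exact ⟨a, rfl, ha⟩

theorem inv (h : N.FreshStep S t k U S') (hS : Inv S) : Inv S' where
  proper :=
    have ⟨_, _, _, _, _, hM'⟩ := h.marking
    hM'.proper
  origin b b' hb hb' hbb' := by
    obtain ⟨B, C, E, hF, hM, hM'⟩ := h.marking
    rcases (hF.token_iff hM').1 hb with ⟨a, rfl, ha⟩ | hb <;>
      rcases (hF.token_iff hM').1 hb' with ⟨a', rfl, ha'⟩ | hb'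
    · rw [hS.origin a a' (total_mono hM.le ha) (total_mono hM.le ha') hbb']
    · cases hS.origin a b' (total_mono hM.le ha) (total_mono hM.symm.le hb') hbb'
      exact absurd hb' (hM.apart _ ha)
    · cases hS.origin b a' (total_mono hM.symm.le hb) (total_mono hM.le ha') hbb'
      exact absurd hb (hM.apart _ ha')
    · exact hS.origin b b' (total_mono hM.symm.le hb) (total_mono hM.symm.le hb') hbb'
  keys b hb l hl := by
    obtain ⟨a, ha, rfl | rfl⟩ := h.exists_pred hb
    · exact (hS.keys _ ha l hl).imp fun _ => h.hist_subset
    · rcases hl with rfl | hl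
      · exact ⟨t, h.key_mem⟩
      · exact (hS.keys a ha l hl).imp fun _ => h.hist_subset
  finite := by
    refine (hS.finite.insert k).subset ?_
    rintro l ⟨t', hl⟩
    rw [h.hist] at hl
    exact hl.elim (fun hl => Or.inr ⟨t', hl⟩) fun hl => Or.inl hl.2

theorem outermost_left {l : ℕ} (h : N.FreshStep S t k U S') (hl : Outermost S' l) :
    Outermost S l := fun b l' u hb =>
  (h.persists hb).elim (fun h' => hl b l' u h') fun h' hlb => hl _ _ _ h' (Or.inr hlb)

/-- If no memory is added on top of those of the first step, then the two steps act on disjoint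
parts of the marking. -/
theorem swap {Q R : State P T A V} {t₁ t₂ : T} {k₁ k₂ : ℕ} {U₁ U₂ : V → Tok A V} (hS : Inv S)
    (h₁ : N.FreshStep S t₁ k₁ U₁ Q) (h₂ : N.FreshStep Q t₂ k₂ U₂ R) (hR : Outermost R k₁) :
    ∃ Q', N.FreshStep S t₂ k₂ U₂ Q' ∧ N.FreshStep Q' t₁ k₁ U₁ R := by
  obtain ⟨B₁, C₁, E₁, hF₁, hS₁, hQ₁⟩ := h₁.marking
  obtain ⟨B₂, C₂, E₂, hF₂, hQ₂, hR₂⟩ := h₂.marking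
  have apart : ∀ b, Sum.inl b ∈ total B₂ →
      Sum.inl b ∉ total (mapMarking (N.stamp t₁ k₁ U₁) C₁) := by
    intro b hb hb'
    rw [total_mapMarking] at hb'
    obtain ⟨a, rfl, -⟩ := Item.inl_mem_image.1 hb'
    exact hR _ _ _ ((hF₂.token_iff hR₂).2 (Or.inl ⟨_, rfl, hb⟩)) (Or.inl rfl)
  have fresh₂ : ∀ t', k₂ ∉ S.H t' := fun t' ht' => h₂.fresh t' (h₁.hist_subset ht')
  have hE₁ : Splits E₁ B₂ (E₁ ⊓ E₂) := hQ₁.inf_of_apart hQ₂ apart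
  have hE₂ : Splits E₂ (mapMarking (N.stamp t₁ k₁ U₁) C₁) (E₁ ⊓ E₂) :=
    inf_comm E₂ E₁ ▸ hQ₂.inf_of_apart hQ₁ fun b hb hb' => apart b hb' hb
  have hS₂ : Splits S.M B₂ (B₁ ⊔ E₁ ⊓ E₂) := hS₁.left_comm hE₁
  have hQ' := hF₂.splits_stamp hS fresh₂ hS₂.right hS₂.symm.le
  refine ⟨⟨_, fun t' => {k' | k' ∈ S.H t' ∨ (t' = t₂ ∧ k' = k₂)}⟩,
    ⟨fresh₂, ⟨B₂, C₂, _, hF₂, hS₂, hQ'⟩, fun _ => rfl⟩, ?_, ⟨B₁, C₁, _, hF₁,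
      hQ'.left_comm (hS₁.sup_of_le hE₁.right hE₁.symm.le), hR₂.left_comm hE₂⟩, fun t' => ?_⟩
  · rintro t' (ht' | ⟨rfl, rfl⟩)
    · exact h₁.fresh t' ht'
    · exact h₂.fresh _ h₁.key_mem
  · rw [h₂.hist, h₁.hist]
    exact Set.ext fun l => or_right_comm

end FreshStep
end MRPN

/-! ### Reversals undo steps -/

namespace MRPN
variable {P T A V : Type*} {N : MRPN P T A V} {S S' S'' : State P T A V} {t : T} {k n : ℕ}
  {U U' : V → Tok A V} {B C : P → Set (Item (Tok A V))}

variable (N) in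
/-- States obtained from initial states by `n` forward steps with fresh keys. -/
inductive Built : ℕ → State P T A V → Prop
  | init {S : State P T A V} (h : N.Initial S) : Built 0 S
  | step {n : ℕ} {S S' : State P T A V} {t : T} {k : ℕ} {U : V → Tok A V} (h : Built n S)
      (h' : N.FreshStep S t k U S') : Built (n + 1) S'

theorem Built.inv (h : N.Built n S) : Inv S := by
  induction h with
  | init h => exact h.inv
  | step _ h' ih => exact h'.inv ih

theorem Built.exists_freshStep_of_outermost (h : N.Built n S) (hk : k ∈ S.H t)
    (out : Outermost S k) :
    ∃ m S' U, n = m + 1 ∧ N.Built m S' ∧ N.FreshStep S' t k U S := by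
  induction h with
  | init h =>
    rw [h.hist] at hk
    exact absurd hk (Set.notMem_empty _)
  | @step n Q S t' k' U' hQ hQS ih =>
    rw [hQS.hist] at hk
    rcases hk with hk | ⟨rfl, rfl⟩
    · obtain ⟨m, Q', U, rfl, hQ', hQ'Q⟩ := ih hk (hQS.outermost_left out)
      obtain ⟨R, hQ'R, hRS⟩ := hQ'Q.swap hQ'.inv hQS out
      exact ⟨m + 1, R, U, rfl, hQ'.step hQ'R, hRS⟩
    · exact ⟨n, Q, U', rfl, hQ, hQS⟩

/-- In all instances in the state, later memories have larger keys. -/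
def KeysSorted (S : State P T A V) : Prop := ∀ a, Sum.inl a ∈ total S.M → a.Sorted

theorem outermost_iff (hS : Inv S) (sorted : KeysSorted S) (hk : k ∈ S.H t) :
    Outermost S k ↔ ∀ o, ¬ Prec S (t, k) o := by
  constructor
  · rintro out ⟨t', k'⟩ ⟨-, -, hlt, x, a, b, u, b', u', ha, hba, hba'⟩
    have hka := Tok.mem_keys_iff.2 ⟨b, u, hba⟩
    have hka' := Tok.mem_keys_iff.2 ⟨b', u', hba'⟩
    cases a with
    | base => exact hka
    | mem c l v =>
      rcases hka with rfl | hkc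
      · rcases hka' with rfl | hkc'
        · exact lt_irrefl _ hlt
        · exact lt_asymm hlt ((sorted _ ⟨x, ha⟩).2 _ hkc')
      · exact out c l v ⟨x, ha⟩ hkc
  · rintro last b l u ⟨x, hx⟩ hkb
    obtain ⟨t', ht'⟩ := hS.keys _ ⟨x, hx⟩ l (Or.inl rfl)
    obtain ⟨c, v, hc⟩ := Tok.mem_keys_iff.1 hkb
    exact last (t', l)
      ⟨hk, ht', (sorted _ ⟨x, hx⟩).2 k hkb, x, _, c, v, b, u, hx, hc.mem _ _, .refl⟩

theorem Fires.rekey (h : N.Fires t U B C) (φ : Equiv.Perm ℕ) :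
    N.Fires t (fun u => (U u).rekey φ) (mapMarking (Tok.rekey φ) B)
      (mapMarking (Tok.rekey φ) C) := by
  have hφ : (Tok.rekey φ : Tok A V → Tok A V).Injective := Tok.rekey_injective φ.injective
  refine ⟨fun u hu v hv huv => h.inj hu hv (hφ huv), fun u hu => ?_, fun a b ha hb hab => ?_, ?_⟩
  · rw [Tok.ty_rekey, h.ty u hu]
  · rw [inItems_map, total_mapMarking] at ha hb ⊢
    rw [total_mapMarking] at hab
    obtain ⟨a', b', rfl, rfl, hab'⟩ := Item.inr_mem_image.1 hab
    exact Set.mem_image_of_mem _ (h.noRecreate a' b'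
      ((Item.map_injective hφ).mem_set_image.1 ha) ((Item.map_injective hφ).mem_set_image.1 hb)
      hab')
  · rw [inItems_map, outItems_map]
    exact h.rearranges.image hφ

theorem stamp_rekey (φ : Equiv.Perm ℕ) (a : Tok A V) :
    N.stamp t (φ k) (fun u => (U u).rekey φ) (a.rekey φ) = (N.stamp t k U a).rekey φ :=
  congrArg (Tok.mem _ _) (role_congr fun _ _ => (Tok.rekey_injective φ.injective).eq_iff)

theorem Fires.inItems_stamp (h : N.Fires t U B C) :
    N.inItems t (fun u => Tok.mem (U u) k (some u)) =
      mapMarking (N.stamp t k U) (N.inItems t U) :=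
  (inItems_congr fun u hu => by rw [stamp, role_apply h.inj hu]).trans (N.inItems_map _ t U)

theorem Fires.outItems_stamp (hN : N.Conservative) (h : N.Fires t U B C) :
    N.outItems t (fun u => Tok.mem (U u) k (some u)) =
      mapMarking (N.stamp t k U) (N.outItems t U) :=
  (outItems_congr fun u hu => by rw [stamp, role_apply h.inj (hN t ▸ hu)]).trans
    (N.outItems_map _ t U)

theorem unstamp_image_stamp (D : Set (Item (Tok A V))) :
    {e | ∃ a u, e = Sum.inl a ∧ Sum.inl (Tok.mem a k u) ∈ Item.map (N.stamp t k U) '' D} ∪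
      {e | ∃ a u b v, e = Sum.inr s(a, b) ∧
        Sum.inr s(Tok.mem a k u, Tok.mem b k v) ∈ Item.map (N.stamp t k U) '' D} = D := by
  apply Set.Subset.antisymm
  · rintro e (⟨a, u, rfl, he⟩ | ⟨a, u, b, v, rfl, he⟩)
    · obtain ⟨a', ha', he'⟩ := Item.inl_mem_image.1 he
      rwa [(Tok.mem.inj ha').1]
    · obtain ⟨a', b', ha', hb', he'⟩ := Item.inr_mem_image.1 he
      rwa [(Tok.mem.inj ha').1, (Tok.mem.inj hb').1]
  · rintro (a | ⟨a, b⟩) he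
    · exact Or.inl ⟨a, _, rfl, _, he, rfl⟩
    · exact Or.inr ⟨a, _, b, _, rfl, _, he, rfl⟩

namespace FreshStep

theorem keysSorted_left (h : N.FreshStep S t k U S') (sorted : KeysSorted S') :
    KeysSorted S := fun a ha =>
  (h.persists ha).elim (sorted a) fun h' => (sorted _ h').1

theorem outermost (h : N.FreshStep S t k U S') (hS : Inv S) : Outermost S' k := by
  intro b l u hb hkb
  obtain ⟨a, e, ha⟩ := h.new_token hS hb (Or.inr hkb)
  cases (Tok.mem.inj e).1
  exact hS.notMem_keys h.fresh ha hkb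

theorem rekey (h : N.FreshStep S t k U S') (φ : Equiv.Perm ℕ) :
    N.FreshStep (S.rekey φ) t (φ k) (fun u => (U u).rekey φ) (S'.rekey φ) where
  fresh := by
    rintro t' ⟨l, hl, e⟩
    cases φ.injective e
    exact h.fresh t' hl
  marking := by
    obtain ⟨B, C, E, hF, hM, hM'⟩ := h.marking
    have hφ : (Tok.rekey φ : Tok A V → Tok A V).Injective := Tok.rekey_injective φ.injective
    refine ⟨_, _, _, hF.rekey φ, hM.image hφ, ?_⟩
    have stamped := hM'.image hφ
    simp only [mapMarking_mapMarking, stamp_rekey] at stamped ⊢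
    exact stamped
  hist t' := by
    change φ '' S'.H t' = _
    rw [h.hist]
    ext l
    constructor
    · rintro ⟨l, hl | ⟨rfl, rfl⟩, rfl⟩
      · exact Or.inl ⟨l, hl, rfl⟩
      · exact Or.inr ⟨rfl, rfl⟩
    · rintro (⟨l, hl, rfl⟩ | ⟨rfl, rfl⟩)
      · exact ⟨l, Or.inl hl, rfl⟩
      · exact ⟨k, Or.inr ⟨rfl, rfl⟩, rfl⟩

theorem target_unique (hN : N.Conservative) (h : N.FreshStep S t k U S')
    (h' : N.FreshStep S t k U' S'') (hU : ∀ u ∈ N.guardVars t, U u = U' u) : S' = S'' := by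
  obtain ⟨B, C, E, hF, hM, hS'⟩ := h.marking
  obtain ⟨B', C', E', hF', hM', hS''⟩ := h'.marking
  have hR := hF.rearranges
  rw [inItems_congr hU, outItems_congr (hN t ▸ hU)] at hR
  obtain ⟨rfl, rfl, rfl⟩ := hR.eq_of_splits hF'.rearranges hM hM'
  refine State.ext ?_ (funext fun t' => (h.hist t').trans (h'.hist t').symm)
  rw [hS'.eq_sup, hS''.eq_sup, stamp_congr hU]

theorem revEnabled (hN : N.Conservative) (h : N.FreshStep S' t k U S) (hS' : Inv S')
    (sorted : KeysSorted S) :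
    N.RevEnabled S t k fun u => Tok.mem (U u) k (some u) := by
  obtain ⟨B, C, E, hF, -, hM⟩ := h.marking
  have out_le : N.outItems t (fun u => Tok.mem (U u) k (some u)) ≤ S.M := by
    rw [hF.outItems_stamp hN]
    exact (hF.rearranges.symm.image stamp_injective).in_le.trans hM.le
  refine ⟨h.key_mem, (outermost_iff (h.inv hS') sorted h.key_mem).1 (h.outermost hS'), ?_,
    fun x u hu => ⟨⟨_, rfl⟩, out_le x ⟨_, hu, rfl⟩, hF.ty u (hN t ▸ ⟨x, hu⟩)⟩,
    fun x u v huv => out_le x ⟨_, huv, rfl⟩⟩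
  rw [← hN t]
  exact fun u hu v hv huv => hF.inj hu hv (Tok.mem.inj huv).1

theorem undo (hN : N.Conservative) (h : N.FreshStep S' t k U S) (hS' : Inv S')
    (sorted : KeysSorted S) :
    N.RevStepWith S t k (fun u => Tok.mem (U u) k (some u)) S' where
  enabled := h.revEnabled hN hS' sorted
  marking x := by
    obtain ⟨B, C, E, hF, hM', hM⟩ := h.marking
    have hR : Rearranges _ _ (mapMarking (N.stamp t k U) C) (mapMarking (N.stamp t k U) B) :=
      hF.rearranges.symm.image stamp_injective
    rw [revIn_eq, revOut_eq, hF.outItems_stamp hN, hF.inItems_stamp, hR.sdiff_removed hM,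
      hR.delivered_eq hM]
    exact (congrFun hM'.symm.eq_sup x).trans (congrArg (E x ∪ ·) (unstamp_image_stamp _).symm)
  hist t' := by
    rw [h.hist]
    ext l
    refine ⟨fun hl => ⟨Or.inl hl, ?_⟩, fun hl => hl.1.resolve_right hl.2⟩
    rintro ⟨rfl, rfl⟩
    exact h.fresh _ hl

theorem eq_of_token (h : N.FreshStep S t k U S') (hS : Inv S) {a : Tok A V} {u : V}
    (ha : Sum.inl (Tok.mem a k (some u)) ∈ total S'.M) : u ∈ N.guardVars t ∧ U u = a := by
  obtain ⟨b, e, -⟩ := h.new_token hS ha (Or.inl rfl)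
  obtain ⟨rfl, -, role_eq⟩ := Tok.mem.inj e
  exact role_eq_some role_eq.symm

theorem exists_token (h : N.FreshStep S t k U S') {u : V} (hu : u ∈ N.guardVars t) :
    Sum.inl (Tok.mem (U u) k (some u)) ∈ total S'.M := by
  obtain ⟨B, C, E, hF, -, hM'⟩ := h.marking
  refine (hF.token_iff hM').2 (Or.inl ⟨U u, by rw [stamp, role_apply hF.inj hu], ?_⟩)
  exact total_mono hF.rearranges.in_le (inl_mem_total_inItems.2 ⟨u, hu, rfl⟩)

theorem eq_of_revStep (hN : N.Conservative) (h : N.FreshStep S' t k U S) (hS' : Inv S')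
    (sorted : KeysSorted S) (h' : N.RevStepWith S t k U' S'') : S'' = S' := by
  have undo := h.undo hN hS' sorted
  have hU : ∀ u ∈ N.guardVars t, U' u = Tok.mem (U u) k (some u) := by
    intro u hu
    obtain ⟨x, hx⟩ : u ∈ N.effectVars t := hN t ▸ hu
    obtain ⟨⟨a, ha⟩, hmem, -⟩ := h'.enabled.tokens x u hx
    rw [ha] at hmem ⊢
    rw [(h.eq_of_token hS' ⟨x, hmem⟩).2]
  refine State.ext (funext fun x => ?_) (funext fun t' => (h'.hist t').trans (undo.hist t').symm)
  rw [undo.marking, h'.marking]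
  simp only [revIn_eq, revOut_eq, inItems_congr hU, outItems_congr (hN t ▸ hU)]

end FreshStep

theorem RevStepWith.exists_freshStep (hN : N.Conservative) (hS : N.Built n S)
    (sorted : KeysSorted S) (h : N.RevStepWith S t k U S') :
    ∃ m U', n = m + 1 ∧ N.Built m S' ∧ N.FreshStep S' t k U' S := by
  obtain ⟨m, S'', U', rfl, hS'', h'⟩ :=
    hS.exists_freshStep_of_outermost h.enabled.occ
      ((outermost_iff hS.inv sorted h.enabled.occ).2 h.enabled.last)
  cases h'.eq_of_revStep hN hS''.inv sorted h
  exact ⟨m, U', rfl, hS'', h'⟩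

theorem FwdStepWith.lt_key (h : N.FwdStepWith S t k U S') {t' : T} {l : ℕ} (hl : l ∈ S.H t') :
    l < k := by
  obtain ⟨m, hm, rfl⟩ := h.key
  exact Nat.lt_succ_of_le (hm.2 (Or.inr ⟨t', hl⟩))

theorem FwdStepWith.freshStep (hN : N.Conservative) (hS : Inv S)
    (h : N.FwdStepWith S t k U S') : N.FreshStep S t k U S' where
  fresh _ hk := lt_irrefl _ (h.lt_key hk)
  marking := by
    obtain ⟨B, C, E, hF, hM⟩ := h.enabled.exists_fires hN hS.proper
    have fresh : ∀ t', k ∉ S.H t' := fun _ hk => lt_irrefl _ (h.lt_key hk)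
    have eq_sup : S'.M = mapMarking (N.stamp t k U) C ⊔ E := by
      funext x
      rw [h.marking, fwdIn_eq, fwdOut_eq, hF.rearranges.sdiff_removed hM,
        hF.rearranges.delivered_eq hM, Set.union_comm]
      rfl
    exact ⟨B, C, E, hF, hM, eq_sup ▸ hF.splits_stamp hS fresh hM.right hM.symm.le⟩
  hist := h.hist

theorem FwdEnabled.exists_step (hS : Inv S) (h : N.FwdEnabled S t U) :
    ∃ k S', N.FwdStepWith S t k U S' := by
  obtain ⟨m, hm, hle⟩ := Set.exists_max_image ({0} ∪ {k' | ∃ t', k' ∈ S.H t'}) id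
    ((Set.finite_singleton 0).union hS.finite) ⟨0, Or.inl rfl⟩
  exact ⟨m + 1, ⟨_, _⟩, h, ⟨m, ⟨hm, hle⟩, rfl⟩, fun x => rfl, fun t' => rfl⟩

variable (N) in
/-- An inductive description of the reachable states: steps with fresh keys build them, and
memories have been added in the order of keys. -/
def Valid (S : State P T A V) : Prop := KeysSorted S ∧ ∃ n, N.Built n S

theorem Valid.inv (hS : N.Valid S) : Inv S :=
  have ⟨_, _, h⟩ := hS
  h.inv

theorem FreshStep.valid (hS : N.Valid S) (h : N.FreshStep S t k U S')
    (hk : ∀ t', ∀ l ∈ S.H t', l < k) : N.Valid S' := by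
  obtain ⟨sorted, n, hn⟩ := hS
  refine ⟨fun b hb => ?_, n + 1, hn.step h⟩
  obtain ⟨a, ha, rfl | rfl⟩ := h.exists_pred hb
  · exact sorted _ ha
  · refine ⟨sorted a ha, fun l hl => ?_⟩
    obtain ⟨t', ht'⟩ := hn.inv.keys a ha l hl
    exact hk t' l ht'

theorem Valid.step (hN : N.Conservative) (hS : N.Valid S) {α : Action T}
    (h : N.Step S α S') : N.Valid S' := by
  cases α with
  | fwd t k =>
    obtain ⟨U, h⟩ := h
    exact (h.freshStep hN hS.inv).valid hS fun t' l => h.lt_key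
  | rev t k =>
    obtain ⟨U, h⟩ := h
    obtain ⟨sorted, n, hn⟩ := hS
    obtain ⟨m, U', -, hm, h'⟩ := h.exists_freshStep hN hn sorted
    exact ⟨h'.keysSorted_left sorted, m, hm⟩

theorem Valid.exec (hN : N.Conservative) (hS : N.Valid S) (e : N.Exec S S') : N.Valid S' := by
  induction e with
  | nil => exact hS
  | cons _ h _ ih => exact ih (hS.step hN h)

theorem Reachable.valid (hN : N.Conservative) (hS : N.Reachable S) : N.Valid S := by
  obtain ⟨S₀, h₀, ⟨e⟩⟩ := hS
  refine Valid.exec hN ⟨?_, 0, .init h₀⟩ e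
  rintro a ⟨x, ha⟩
  obtain ⟨b, i, rfl⟩ := h₀.base x a ha
  trivial

end MRPN

/-! ### Causal equivalence preserves the final state -/

namespace MRPN
variable {P T A V : Type*} {N : MRPN P T A V} {S S' S'' Q Q' R : State P T A V} {t : T} {k l : ℕ}
  {U W : V → Tok A V} {φ : Equiv.Perm ℕ} {α β γ : Action T}

namespace MarkEquiv

theorem refl (S : State P T A V) : MarkEquiv S S :=
  State.markEquiv_iff.2 ⟨.refl ℕ, S.rekey_refl.symm⟩

theorem symm (h : MarkEquiv S S') : MarkEquiv S' S := by
  obtain ⟨φ, rfl⟩ := State.markEquiv_iff.1 h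
  exact State.markEquiv_iff.2 ⟨φ.symm, (S.rekey_rekey_symm φ).symm⟩

theorem trans (h : MarkEquiv S S') (h' : MarkEquiv S' S'') : MarkEquiv S S'' := by
  obtain ⟨φ, rfl⟩ := State.markEquiv_iff.1 h
  obtain ⟨ψ, rfl⟩ := State.markEquiv_iff.1 h'
  exact State.markEquiv_iff.2 ⟨_, State.rekey_rekey φ ψ S⟩

end MarkEquiv

theorem Prec.rekey (hS : KeysSorted S) (hφ : KeysSorted (S.rekey φ)) {o o' : T × ℕ}
    (h : Prec S o o') : Prec (S.rekey φ) (o.1, φ o.2) (o'.1, φ o'.2) := by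
  obtain ⟨ho, ho', hlt, x, a, b, u, b', u', ha, hb, hb'⟩ := h
  have ha' : Sum.inl (a.rekey φ) ∈ (S.rekey φ).M x := ⟨_, ha, rfl⟩
  have hk := Tok.mem_keys_iff.2 ⟨b, u, hb⟩
  have hk' := Tok.mem_keys_iff.2 ⟨b', u', hb'⟩
  have keys_image {m : ℕ} (hm : m ∈ a.keys) : φ m ∈ (a.rekey φ).keys :=
    Tok.keys_rekey φ a ▸ Set.mem_image_of_mem φ hm
  obtain ⟨c, v, hc⟩ := Tok.mem_keys_iff.1 (keys_image hk)
  obtain ⟨c', v', hc'⟩ := Tok.mem_keys_iff.1 (keys_image hk')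
  exact ⟨⟨_, ho, rfl⟩, ⟨_, ho', rfl⟩, (hS a ⟨x, ha⟩).lt_of_lt (hφ _ ⟨x, ha'⟩) hk hk' hlt,
    x, _, c, v, c', v', ha', hc, hc'⟩

theorem CausalPath.rekey (hS : KeysSorted S) (hφ : KeysSorted (S.rekey φ)) {p : List (T × ℕ)}
    (h : CausalPath S p) : CausalPath (S.rekey φ) (p.map fun o => (o.1, φ o.2)) := by
  obtain ⟨nonempty, occ, chain⟩ := h
  refine ⟨mt List.map_eq_nil_iff.1 nonempty, ?_, ?_⟩
  · intro o ho
    obtain ⟨o', ho', rfl⟩ := List.mem_map.1 ho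
    exact ⟨_, occ o' ho', rfl⟩
  · rw [List.isChain_map]
    exact chain.imp fun _ _ h => h.rekey hS hφ

theorem MarkEquiv.exists_causalPath (h : MarkEquiv S S') (hS : KeysSorted S)
    (hS' : KeysSorted S') {p : List (T × ℕ)} (hp : CausalPath S p) :
    ∃ q, CausalPath S' q ∧ q.map Prod.fst = p.map Prod.fst := by
  obtain ⟨φ, rfl⟩ := State.markEquiv_iff.1 h
  exact ⟨_, hp.rekey hS hS', List.map_map⟩

theorem stateEquiv_iff_markEquiv (hS : KeysSorted S) (hS' : KeysSorted S') :
    StateEquiv S S' ↔ MarkEquiv S S' :=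
  ⟨And.left, fun h => ⟨h, fun _ => h.exists_causalPath hS hS',
    fun _ => h.symm.exists_causalPath hS' hS⟩⟩

theorem Inv.rekey (hS : Inv S) (φ : Equiv.Perm ℕ) : Inv (S.rekey φ) where
  proper := hS.proper.image (Tok.rekey_injective φ.injective)
  origin a b ha hb hab := by
    rw [State.rekey, total_mapMarking] at ha hb
    obtain ⟨a, rfl, ha'⟩ := Item.inl_mem_image.1 ha
    obtain ⟨b, rfl, hb'⟩ := Item.inl_mem_image.1 hb
    rw [Tok.origin_rekey, Tok.origin_rekey] at hab
    rw [hS.origin a b ha' hb' hab]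
  keys a ha k hk := by
    rw [State.rekey, total_mapMarking] at ha
    obtain ⟨a, rfl, ha'⟩ := Item.inl_mem_image.1 ha
    rw [Tok.keys_rekey] at hk
    obtain ⟨k, hk, rfl⟩ := hk
    obtain ⟨t, ht⟩ := hS.keys a ha' k hk
    exact ⟨t, k, ht, rfl⟩
  finite := by
    refine (hS.finite.image φ).subset ?_
    rintro _ ⟨t, k, hk, rfl⟩
    exact ⟨k, ⟨t, hk⟩, rfl⟩

namespace FreshStep

theorem token_mem (h : N.FreshStep S t k U S') {u : V} (hu : u ∈ N.guardVars t) :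
    Sum.inl (U u) ∈ total S.M := by
  obtain ⟨B, C, E, hF, hM, -⟩ := h.marking
  exact total_mono (hF.rearranges.in_le.trans hM.le) (inl_mem_total_inItems.2 ⟨u, hu, rfl⟩)

theorem uses_iff (h : N.FreshStep S t k U S') (hS : Inv S) {u : V} {o : A × ℕ} :
    N.Uses t S'.M k u o ↔ u ∈ N.guardVars t ∧ (U u).origin = o := by
  constructor
  · rintro ⟨hu, x, a, rfl, ha⟩
    rw [(h.eq_of_token hS ⟨x, ha⟩).2]
    exact ⟨hu, rfl⟩
  · rintro ⟨hu, rfl⟩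
    obtain ⟨x, hx⟩ := h.exists_token hu
    exact ⟨hu, x, _, rfl, hx⟩

theorem origin_eq_of_uses (h : N.FreshStep S t k U S') (hS : Inv S)
    (h' : N.FreshStep Q t l W Q') (hQ : Inv Q)
    (hU : ∀ u o, N.Uses t S'.M k u o ↔ N.Uses t Q'.M l u o) :
    ∀ u ∈ N.guardVars t, (U u).origin = (W u).origin := fun u hu =>
  ((h.uses_iff hS).1 ((hU u _).2 ((h'.uses_iff hQ).2 ⟨hu, rfl⟩))).2

theorem mem_hist_iff (h : N.FreshStep S t k U S') {t' : T} : k ∈ S'.H t' ↔ t' = t := by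
  rw [h.hist]
  exact ⟨fun hk => hk.elim (fun hk => absurd hk (h.fresh t')) And.left,
    fun ht' => Or.inr ⟨ht', rfl⟩⟩

theorem markEquiv (hN : N.Conservative) (hS : Inv S) (h : N.FreshStep S t k U S')
    (h' : N.FreshStep (S.rekey φ) t l W Q')
    (hU : ∀ u ∈ N.guardVars t, (U u).origin = (W u).origin) : MarkEquiv S' Q' := by
  -- The renaming `φ` is irrelevant outside the history of `S`, so that it may be changed at `k`.
  set ψ := φ.trans (Equiv.swap (φ k) l)
  have ψ_apply : ψ k = l := Equiv.swap_apply_left _ _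
  have eq_on_hist : ∀ t', ∀ m ∈ S.H t', φ m = ψ m := by
    intro t' m hm
    refine (Equiv.swap_apply_of_ne_of_ne (fun e => ?_) fun e => ?_).symm
    · exact h.fresh t' (φ.injective e ▸ hm)
    · exact h'.fresh t' ⟨m, hm, e⟩
  have rekey_eq : S.rekey φ = S.rekey ψ := by
    refine State.rekey_congr hS.proper (fun a ha m hm => ?_)
      fun t' => Set.image_congr (eq_on_hist t')
    obtain ⟨t', ht'⟩ := hS.keys a ha m hm
    exact eq_on_hist t' m ht'
  have hψ := h.rekey ψ
  rw [ψ_apply, ← rekey_eq] at hψ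
  refine State.markEquiv_iff.2 ⟨ψ, h'.target_unique hN hψ fun u hu => ?_⟩
  exact (hS.rekey φ).origin _ _ (h'.token_mem hu) (hψ.token_mem hu)
    ((hU u hu).symm.trans (Tok.origin_rekey _ _).symm)

theorem notMem_keys_of_guardVars_eq_empty (h : N.FreshStep S t k U S') (hS : Inv S)
    (ht : N.guardVars t = ∅) {a : Tok A V} (ha : Sum.inl a ∈ total S'.M) : k ∉ a.keys := by
  obtain ⟨B, C, E, hF, hM, hM'⟩ := h.marking
  rcases (hF.token_iff hM').1 ha with ⟨b, -, x, hb⟩ | hE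
  · rw [← hF.rearranges.gather_in] at hb
    obtain ⟨c, hc, -⟩ := hb
    obtain ⟨u, -, hu⟩ := inl_mem_inItems.1 hc
    exact absurd (show u ∈ N.guardVars t from ⟨x, hu⟩) (ht ▸ Set.notMem_empty u)
  · exact hS.notMem_keys h.fresh (total_mono hM.symm.le hE)

/-- The key of a transition without variables leaves no trace in the marking, so that the renaming
can be chosen to match it. -/
theorem exists_rekey_key (hS : Inv S) (hQ : Inv Q) (h : N.FreshStep S t k U S')
    (h' : N.FreshStep Q t l W (S'.rekey φ))
    (hU : ∀ u ∈ N.guardVars t, (U u).origin = (W u).origin) :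
    ∃ ψ : Equiv.Perm ℕ, S'.rekey φ = S'.rekey ψ ∧ ψ k = l := by
  rcases (N.guardVars t).eq_empty_or_nonempty with ht | ⟨u, hu⟩
  · refine ⟨φ.trans (Equiv.swap (φ k) l), ?_, Equiv.swap_apply_left _ _⟩
    refine State.rekey_congr (h.inv hS).proper (fun a ha m hm => ?_) fun t' => ?_
    · refine (Equiv.swap_apply_of_ne_of_ne (fun e => ?_) fun e => ?_).symm
      · exact h.notMem_keys_of_guardVars_eq_empty hS ht ha (φ.injective e ▸ hm)
      · obtain ⟨x, ha⟩ := ha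
        refine h'.notMem_keys_of_guardVars_eq_empty hQ ht ⟨x, _, ha, rfl⟩ ?_
        rw [Tok.keys_rekey]
        exact ⟨m, hm, e⟩
    · rw [Equiv.coe_trans, Set.image_comp]
      refine (Set.BijOn.image_eq (Equiv.swap_bijOn_self ?_)).symm
      rw [φ.injective.mem_set_image, h.mem_hist_iff]
      exact h'.mem_hist_iff.symm
  · have same_token := (h'.inv hQ).origin _ _ ((h.rekey φ).exists_token hu) (h'.exists_token hu)
      ((Tok.origin_rekey _ _).trans (hU u hu))
    exact ⟨φ, rfl, (Tok.mem.inj same_token).2.1⟩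

theorem markEquiv_left (hN : N.Conservative) (hS : Inv S) (hQ : Inv Q)
    (sorted : KeysSorted (S'.rekey φ)) (h : N.FreshStep S t k U S')
    (h' : N.FreshStep Q t l W (S'.rekey φ))
    (hU : ∀ u ∈ N.guardVars t, (U u).origin = (W u).origin) : MarkEquiv S Q := by
  obtain ⟨ψ, rekey_eq, ψ_apply⟩ := h.exists_rekey_key hS hQ h' hU
  have hψ := h.rekey ψ
  rw [ψ_apply, ← rekey_eq] at hψ
  refine State.markEquiv_iff.2 ⟨ψ, ?_⟩
  exact (h'.eq_of_revStep hN hQ sorted (hψ.undo hN (hS.rekey ψ) sorted)).symm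

theorem equivOcc (hS : Inv S) (h : N.FreshStep S t k U S') (h' : N.FreshStep S t l U S'') :
    N.EquivOcc t S'.M k S''.M l := by
  obtain ⟨B, C, E, hF, hM, hS'⟩ := h.marking
  obtain ⟨B', C', E', hF', hM', hS''⟩ := h'.marking
  obtain ⟨rfl, rfl, rfl⟩ := hF.rearranges.eq_of_splits hF'.rearranges hM hM'
  intro x a u _ ha
  rw [hS'.eq_sup] at ha
  rw [hS''.eq_sup]
  rcases ha with ha | ha
  · obtain ⟨b, e, hb⟩ := Item.inl_mem_image.1 ha
    obtain ⟨rfl, -, role_eq⟩ := Tok.mem.inj e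
    exact Or.inl ⟨_, hb, congrArg (fun w => Sum.inl (Tok.mem a l w)) role_eq.symm⟩
  · exact absurd (Or.inl rfl) (hS.notMem_keys h.fresh ⟨x, hM.symm.le x ha⟩)

end FreshStep

theorem SameAction.refl (α : Action T) : N.SameAction S α S' S α S' := by
  cases α <;> exact ⟨rfl, fun _ _ => Iff.rfl⟩

theorem SameAction.symm (h : N.SameAction S α S' Q β Q') : N.SameAction Q β Q' S α S' := by
  cases α <;> cases β <;> first | exact h.elim | skip
  all_goals
    obtain ⟨rfl, h⟩ := h
    exact ⟨rfl, fun u o => (h u o).symm⟩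

theorem SameAction.trans {R' : State P T A V} (h : N.SameAction S α S' Q β Q')
    (h' : N.SameAction Q β Q' R γ R') : N.SameAction S α S' R γ R' := by
  cases α <;> cases β <;> first | exact h.elim | skip
  all_goals cases γ <;> first | exact h'.elim | skip
  all_goals
    obtain ⟨rfl, h⟩ := h
    obtain ⟨rfl, h'⟩ := h'
    exact ⟨rfl, fun u o => (h u o).trans (h' u o)⟩

theorem SameAction.markEquiv (hN : N.Conservative) (hS : N.Valid S) (hQ : N.Valid Q)
    (hSQ : MarkEquiv S Q) (h₁ : N.Step S α S') (h₂ : N.Step Q β Q')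
    (h : N.SameAction S α S' Q β Q') : MarkEquiv S' Q' := by
  obtain ⟨φ, rfl⟩ := State.markEquiv_iff.1 hSQ
  cases α <;> cases β <;> first | exact h.elim | skip
  · obtain ⟨rfl, h⟩ := h
    obtain ⟨U, h₁⟩ := h₁
    obtain ⟨W, h₂⟩ := h₂
    have f₁ := h₁.freshStep hN hS.inv
    have f₂ := h₂.freshStep hN hQ.inv
    exact f₁.markEquiv hN hS.inv f₂ (f₁.origin_eq_of_uses hS.inv f₂ hQ.inv h)
  · obtain ⟨rfl, h⟩ := h
    obtain ⟨_, h₁⟩ := h₁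
    obtain ⟨_, h₂⟩ := h₂
    obtain ⟨sorted, n, hn⟩ := hS
    obtain ⟨sorted', n', hn'⟩ := hQ
    obtain ⟨_, U, -, hS', f₁⟩ := h₁.exists_freshStep hN hn sorted
    obtain ⟨_, W, -, hQ', f₂⟩ := h₂.exists_freshStep hN hn' sorted'
    exact f₁.markEquiv_left hN hS'.inv hQ'.inv sorted' f₂
      (f₁.origin_eq_of_uses hS'.inv f₂ hQ'.inv h)

theorem SameTrace.refl (e : N.Exec S S') : N.SameTrace e e := by
  induction e with
  | nil => exact .nil _ _
  | cons α h e ih => exact .cons h h (.refl α) ih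

theorem SameTrace.markEquiv (hN : N.Conservative) {e : N.Exec S S'} {f : N.Exec Q Q'}
    (h : N.SameTrace e f) (hS : N.Valid S) (hQ : N.Valid Q) (hSQ : MarkEquiv S Q) :
    MarkEquiv S' Q' := by
  induction h with
  | nil => exact hSQ
  | cons h₁ h₂ h _ ih => exact ih (hS.step hN h₁) (hQ.step hN h₂) (h.markEquiv hN hS hQ hSQ h₁ h₂)

theorem eq_of_fwd_rev (hN : N.Conservative) (hS : N.Valid S) (h : N.Step S (.fwd t k) S')
    (h' : N.Step S' (.rev t k) S'') : S'' = S := by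
  have sorted := (hS.step hN h).1
  obtain ⟨U, h⟩ := h
  obtain ⟨W, h'⟩ := h'
  exact (h.freshStep hN hS.inv).eq_of_revStep hN hS.inv sorted h'

theorem markEquiv_of_rev_fwd (hN : N.Conservative) (hS : N.Valid S) (h : N.Step S (.rev t k) S')
    (h' : N.Step S' (.fwd t l) S'') (heq : N.EquivOcc t S.M k S''.M l) : MarkEquiv S'' S := by
  have hS' := (hS.step hN h).inv
  obtain ⟨U, h⟩ := h
  obtain ⟨W, h'⟩ := h'
  obtain ⟨sorted, n, hn⟩ := hS
  obtain ⟨_, U, -, -, f⟩ := h.exists_freshStep hN hn sorted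
  have f' := h'.freshStep hN hS'
  rw [← S'.rekey_refl] at f'
  refine (f.markEquiv hN hS' f' fun u hu => ?_).symm
  rw [S'.rekey_refl] at f'
  obtain ⟨x, hx⟩ := f.exists_token hu
  rw [(f'.eq_of_token hS' ⟨x, heq x _ u hu hx⟩).2]

theorem CausEq.markEquiv (hN : N.Conservative) {e : N.Exec S S'} {f : N.Exec S S''}
    (h : N.CausEq e f) (hS : N.Valid S) : MarkEquiv S' S'' := by
  induction h with
  | refl => exact .refl _
  | symm _ ih => exact (ih hS).symm
  | trans _ _ ih ih' => exact (ih hS).trans (ih' hS)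
  | @comp _ _ _ _ _ _ c e f _ _ _ hf ih =>
    have hS' := hS.exec hN c
    exact hf.markEquiv hN (hS'.exec hN e) (hS'.exec hN f) (ih hS')
  | swap h₁ k₂ h₂ k₁ hc s₂ s₁ =>
    obtain ⟨_, _, _, _, g₂, r₂, g₁, r₁, hR⟩ := hc
    have hS₁ := hS.step hN h₁
    have hS₂ := hS.step hN h₂
    have left := (s₂.symm.trans r₂).markEquiv hN hS₁ hS₁ (.refl _) k₂ g₂
    have right := (s₁.symm.trans r₁).markEquiv hN hS₂ hS₂ (.refl _) k₁ g₁
    exact (left.trans hR.1).trans right.symm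
  | cancelFwdRev h h' =>
    cases eq_of_fwd_rev hN hS h h'
    exact .refl _
  | cancelRevFwd h h' heq => exact markEquiv_of_rev_fwd hN hS h h' heq

end MRPN

/-! ### Commuting and redoing reversals -/

namespace MRPN
variable {P T A V : Type*} {N : MRPN P T A V} {S S' S₀ S₁ S₂ Z Z₁ Z₂ : State P T A V}
  {t t₁ t₂ : T} {k k₁ k₂ n : ℕ} {U : V → Tok A V}

theorem Exec.comp_nil (e : N.Exec S S') : e.comp (.nil S') = e := by
  induction e with
  | nil => rfl
  | cons α h e ih => exact congrArg _ ih

theorem Exec.comp_assoc (e : N.Exec S₀ S₁) (f : N.Exec S₁ S₂) (g : N.Exec S₂ Z) :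
    (e.comp f).comp g = e.comp (f.comp g) := by
  induction e with
  | nil => rfl
  | cons α h e ih => exact congrArg _ (ih f)

theorem CausEq.comp_left (c : N.Exec S₀ S) {e : N.Exec S S₁} {f : N.Exec S S₂}
    (h : N.CausEq e f) : N.CausEq (c.comp e) (c.comp f) := by
  have extended := CausEq.comp c h (.nil S₁ S₂)
  rwa [Exec.comp_nil, Exec.comp_nil] at extended

theorem CausEq.comp_right {e : N.Exec S S₁} {f : N.Exec S S₂} {g : N.Exec S₁ Z₁}
    {g' : N.Exec S₂ Z₂} (h : N.CausEq e f) (hg : N.SameTrace g g') :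
    N.CausEq (e.comp g) (f.comp g') :=
  .comp (.nil S) h hg

theorem CausEq.cons {α : Action T} (hα : N.Step S α S') {e : N.Exec S' S₁} {f : N.Exec S' S₂}
    (h : N.CausEq e f) : N.CausEq (.cons α hα e) (.cons α hα f) :=
  h.comp_left (.cons α hα (.nil S'))

theorem FreshStep.exists_redo (hN : N.Conservative) (hS : Inv S) (sorted : KeysSorted S')
    (h : N.FreshStep S t k U S') :
    ∃ l R, ∃ (r : N.Step S' (.rev t k) S) (f : N.Step S (.fwd t l) R),
      N.CausEq (.cons _ r (.cons _ f (.nil R))) (.nil S') ∧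
      ∀ u o, N.Uses t R.M l u o ↔ u ∈ N.guardVars t ∧ (U u).origin = o := by
  obtain ⟨B, C, E, hF, hM, -⟩ := h.marking
  obtain ⟨l, R, f⟩ := (hF.fwdEnabled hM).exists_step hS
  have hf := f.freshStep hN hS
  exact ⟨l, R, ⟨_, h.undo hN hS sorted⟩, ⟨U, f⟩, .cancelRevFwd _ _ (h.equivOcc hS hf),
    fun u o => hf.uses_iff hS⟩

theorem Built.of_rev (hN : N.Conservative) (hS : N.Built n S) (sorted : KeysSorted S)
    (h : N.Step S (.rev t k) S') :
    ∃ m U, n = m + 1 ∧ N.Built m S' ∧ KeysSorted S' ∧ N.FreshStep S' t k U S := by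
  obtain ⟨_, h⟩ := h
  obtain ⟨m, U, e, hS', f⟩ := h.exists_freshStep hN hS sorted
  exact ⟨m, U, e, hS', f.keysSorted_left sorted, f⟩

theorem Valid.rev_unique (hN : N.Conservative) (hS : N.Valid S) (h₁ : N.Step S (.rev t₁ k) S₁)
    (h₂ : N.Step S (.rev t₂ k) S₂) : t₁ = t₂ ∧ S₁ = S₂ := by
  obtain ⟨sorted, n, hn⟩ := hS
  obtain ⟨_, _, -, -, -, f₁⟩ := hn.of_rev hN sorted h₁
  obtain ⟨_, _, -, hS₂, -, f₂⟩ := hn.of_rev hN sorted h₂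
  obtain rfl := f₂.mem_hist_iff.1 f₁.key_mem
  obtain ⟨_, h₁⟩ := h₁
  exact ⟨rfl, f₂.eq_of_revStep hN hS₂.inv sorted h₁⟩

theorem FreshStep.exists_swap {U₁ U₂ : V → Tok A V} (hN : N.Conservative)
    (sorted : KeysSorted S) (hS₁ : N.Built n S₁) (hS₂ : Inv S₂)
    (f₁ : N.FreshStep S₁ t₁ k₁ U₁ S) (f₂ : N.FreshStep S₂ t₂ k₂ U₂ S) (hk : k₁ ≠ k₂) :
    ∃ Q W, Inv Q ∧ N.FreshStep Q t₂ k₂ W S₁ ∧ N.FreshStep Q t₁ k₁ U₁ S₂ ∧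
      N.FreshStep S₂ t₂ k₂ W S := by
  have mem : k₂ ∈ S₁.H t₂ := by
    have mem := f₂.key_mem
    rw [f₁.hist] at mem
    exact mem.resolve_right fun h => hk h.2.symm
  have out₂ := f₂.outermost hS₂
  obtain ⟨_, Q, W, -, hQ, g₂⟩ := hS₁.exists_freshStep_of_outermost mem (f₁.outermost_left out₂)
  obtain ⟨Q', g₁, g₂'⟩ := g₂.swap hQ.inv f₁ out₂
  cases f₂.eq_of_revStep hN hS₂ sorted (g₂'.undo hN (g₁.inv hQ.inv) sorted)
  exact ⟨Q, W, hQ.inv, g₂, g₁, g₂'⟩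

theorem Valid.exists_commuting_revs (hN : N.Conservative) (hS : N.Valid S)
    (h₁ : N.Step S (.rev t₁ k₁) S₁) (h₂ : N.Step S (.rev t₂ k₂) S₂) (hk : k₁ ≠ k₂) :
    ∃ Q, ∃ (s₁ : N.Step S₁ (.rev t₂ k₂) Q) (s₂ : N.Step S₂ (.rev t₁ k₁) Q),
      N.CausEq (.cons _ h₁ (.cons _ s₁ (.nil Q))) (.cons _ h₂ (.cons _ s₂ (.nil Q))) := by
  obtain ⟨sorted, n, hn⟩ := hS
  obtain ⟨_, U₁, -, hS₁, sorted₁, f₁⟩ := hn.of_rev hN sorted h₁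
  obtain ⟨_, U₂, -, hS₂, sorted₂, f₂⟩ := hn.of_rev hN sorted h₂
  obtain ⟨Q, W, hQ, g₂, g₁, g₂'⟩ := f₁.exists_swap hN sorted hS₁ hS₂.inv f₂ hk
  have s₁ : N.Step S₁ (.rev t₂ k₂) Q := ⟨_, g₂.undo hN hQ sorted₁⟩
  have s₂ : N.Step S₂ (.rev t₁ k₁) Q := ⟨_, g₁.undo hN hQ sorted₂⟩
  have same₂ : N.SameAction S (.rev t₂ k₂) S₂ S₁ (.rev t₂ k₂) Q :=
    ⟨rfl, fun u o => (g₂'.uses_iff hS₂.inv).trans (g₂.uses_iff hQ).symm⟩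
  have same₁ : N.SameAction S (.rev t₁ k₁) S₁ S₂ (.rev t₁ k₁) Q :=
    ⟨rfl, fun u o => (f₁.uses_iff hS₁.inv).trans (g₁.uses_iff hQ).symm⟩
  have sortedQ := g₂.keysSorted_left sorted₁
  exact ⟨Q, s₁, s₂, .swap h₁ s₁ h₂ s₂ ⟨_, Q, _, Q, s₁, same₂, s₂, same₁,
    (stateEquiv_iff_markEquiv sortedQ sortedQ).2 (.refl Q)⟩ same₂ same₁⟩

/-- Executions that reverse all occurrences, without any forward step. -/
inductive Exec.Unwinds : ∀ {S Z : State P T A V}, N.Exec S Z → Prop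
  | nil {S : State P T A V} (h : ∀ t, S.H t = ∅) : Unwinds (.nil S)
  | cons {S S' Z : State P T A V} {t : T} {k : ℕ} (h : N.Step S (.rev t k) S')
      {e : N.Exec S' Z} (he : e.Unwinds) : Unwinds (.cons (.rev t k) h e)

theorem Step.mem_hist (h : N.Step S (.rev t k) S') : k ∈ S.H t :=
  have ⟨_, h⟩ := h
  h.enabled.occ

theorem Built.exists_unwinds (hN : N.Conservative) (hS : N.Built n S) (sorted : KeysSorted S) :
    ∃ (Z : State P T A V) (e : N.Exec S Z), e.Unwinds := by
  induction hS with
  | init h => exact ⟨_, .nil _, .nil h.hist⟩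
  | step hS f ih =>
    obtain ⟨Z, e, he⟩ := ih (f.keysSorted_left sorted)
    exact ⟨Z, _, .cons ⟨_, f.undo hN hS.inv sorted⟩ he⟩

theorem Exec.Unwinds.causEq (hN : N.Conservative) (hS : N.Built n S) (sorted : KeysSorted S)
    {e₁ : N.Exec S Z₁} {e₂ : N.Exec S Z₂} (h₁ : e₁.Unwinds) (h₂ : e₂.Unwinds) :
    N.CausEq e₁ e₂ := by
  induction n using Nat.strong_induction_on generalizing S Z₁ Z₂ with
  | h n ih =>
  cases h₁ with
  | nil empty =>
    cases h₂ with
    | nil => exact .refl _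
    | cons r₂ => exact absurd (empty _ ▸ Step.mem_hist r₂) (Set.notMem_empty _)
  | @cons _ S₁ _ t₁ k₁ r₁ _ h₁ =>
    cases h₂ with
    | nil empty => exact absurd (empty _ ▸ Step.mem_hist r₁) (Set.notMem_empty _)
    | @cons _ S₂ _ t₂ k₂ r₂ _ h₂ =>
      obtain ⟨m, _, rfl, hS₁, sorted₁, -⟩ := hS.of_rev hN sorted r₁
      obtain ⟨_, _, ⟨⟩, hS₂, sorted₂, -⟩ := hS.of_rev hN sorted r₂
      have ih {S Z₁ Z₂} {e₁ : N.Exec S Z₁} {e₂ : N.Exec S Z₂} (hS : N.Built m S) :=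
        ih m (Nat.lt_succ_self m) (e₁ := e₁) (e₂ := e₂) hS
      rcases eq_or_ne k₁ k₂ with rfl | hk
      · obtain ⟨rfl, rfl⟩ := Valid.rev_unique hN ⟨sorted, _, hS⟩ r₁ r₂
        exact (ih hS₁ sorted₁ h₁ h₂).cons r₁
      · obtain ⟨Q, s₁, s₂, commute⟩ :=
          Valid.exists_commuting_revs hN ⟨sorted, _, hS⟩ r₁ r₂ hk
        obtain ⟨_, _, -, hQ, sortedQ, -⟩ := hS₁.of_rev hN sorted₁ s₁
        obtain ⟨Z, g, hg⟩ := hQ.exists_unwinds hN sortedQ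
        exact ((ih hS₁ sorted₁ h₁ (.cons s₁ hg)).cons r₁).trans
          ((commute.comp_right (.refl g)).trans ((ih hS₂ sorted₂ h₂ (.cons s₂ hg)).cons r₂).symm)

theorem Exec.exists_unwinds_causEq (hN : N.Conservative) (e : N.Exec S Z) (hS : N.Valid S)
    (hZ : ∀ t, Z.H t = ∅) : ∃ (Z' : State P T A V) (f : N.Exec S Z'), f.Unwinds ∧ N.CausEq e f := by
  induction e with
  | nil S => exact ⟨S, .nil S, .nil hZ, .refl _⟩
  | cons α h e ih =>
    have hS' := hS.step hN h
    obtain ⟨Z', f, hf, hef⟩ := ih hS' hZ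
    cases α with
    | rev t k => exact ⟨Z', .cons _ h f, .cons h hf, hef.cons h⟩
    | fwd t k =>
      obtain ⟨sorted, n, hn⟩ := hS
      obtain ⟨sorted', n', hn'⟩ := hS'
      obtain ⟨Z'', g, hg⟩ := hn.exists_unwinds hN sorted
      have ⟨_, hU⟩ := h
      have r : N.Step _ (.rev t k) _ := ⟨_, (hU.freshStep hN hn.inv).undo hN hn.inv sorted'⟩
      exact ⟨Z'', g, hg, (hef.cons h).trans (((hf.causEq hN hn' sorted' (.cons r hg)).cons h).trans
        (.comp_right (.cancelFwdRev h r) (.refl g)))⟩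

theorem Valid.causEq_of_markEquiv (hN : N.Conservative) (hS : N.Valid S) {e₁ : N.Exec S S₁}
    {e₂ : N.Exec S S₂} (h : MarkEquiv S₁ S₂) : N.CausEq e₁ e₂ := by
  obtain ⟨φ, rfl⟩ := State.markEquiv_iff.1 h
  have ⟨sorted₁, _, hS₁⟩ := hS.exec hN e₁
  have sorted₂ := (hS.exec hN e₂).1
  clear h
  induction hS₁ with
  | init h =>
    obtain ⟨_, f₁, hf₁, c₁⟩ := e₁.exists_unwinds_causEq hN hS h.hist
    obtain ⟨_, f₂, hf₂, c₂⟩ := e₂.exists_unwinds_causEq hN hS fun t =>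
      (congrArg (φ '' ·) (h.hist t)).trans (Set.image_empty φ)
    obtain ⟨sorted, n, hn⟩ := hS
    exact c₁.trans ((hf₁.causEq hN hn sorted hf₂).trans c₂.symm)
  | @step n Q S₁ t k U hQ h ih =>
    have hφQ := hQ.inv.rekey φ
    obtain ⟨l₁, R₁, r₁, f₁, c₁, uses₁⟩ := h.exists_redo hN hQ.inv sorted₁
    obtain ⟨l₂, R₂, r₂, f₂, c₂, uses₂⟩ := (h.rekey φ).exists_redo hN hφQ sorted₂
    have same : N.SameAction Q (.fwd t l₁) R₁ (Q.rekey φ) (.fwd t l₂) R₂ :=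
      ⟨rfl, fun u o => by rw [uses₁, uses₂, Tok.origin_rekey]⟩
    have undone := ih (e₁ := e₁.comp (.cons _ r₁ (.nil Q))) (e₂ := e₂.comp (.cons _ r₂ (.nil _)))
      (h.keysSorted_left sorted₁) ((h.rekey φ).keysSorted_left sorted₂)
    have redone := undone.comp_right (.cons f₁ f₂ same (.nil R₁ R₂))
    rw [Exec.comp_assoc, Exec.comp_assoc] at redone
    have c₁ := c₁.comp_left e₁
    have c₂ := c₂.comp_left e₂
    rw [Exec.comp_nil] at c₁ c₂
    exact c₁.symm.trans (redone.trans c₂)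

end MRPN

end MultiRPN

theorem mainTheorem2_general {P T A V : Type*} (N : MultiRPN.MRPN P T A V) (hN : N.Conservative)
    (S S₁ S₂ : MultiRPN.State P T A V) (hS : N.Reachable S)
    (e₁ : N.Exec S S₁) (e₂ : N.Exec S S₂) :
    N.CausEq e₁ e₂ ↔ MultiRPN.MRPN.StateEquiv S₁ S₂ := by
  have valid := hS.valid hN
  rw [MultiRPN.MRPN.stateEquiv_iff_markEquiv (valid.exec hN e₁).1 (valid.exec hN e₂).1]
  exact ⟨fun h => h.markEquiv hN valid, valid.causEq_of_markEquiv hN⟩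

theorem mainTheorem2 {P T A V : Type*} [Finite P] [Finite T] [Finite A] [Finite V]
    (N : MultiRPN.MRPN P T A V) (hN : N.WellFormed)
    (S S₁ S₂ : MultiRPN.State P T A V) (hS : N.Reachable S)
    (e₁ : N.Exec S S₁) (e₂ : N.Exec S S₂) :
    N.CausEq e₁ e₂ ↔ MultiRPN.MRPN.StateEquiv S₁ S₂ :=
  mainTheorem2_general N (fun t => (hN t).1) S S₁ S₂ hS e₁ e₂
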